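/- Let $P$ be a poset in which the lengths of chains are bounded and in which, for all $x\le y$, all maximal chains from $x$ to $y$ have the same length, denoted $r[x,y]$ (a chain $p_0<p_1<\dots<p_k$ has length $k$). The *orthoscheme complex* $K(P)$ is the set of all formal convex combinations $\sum_i\lambda_i p_i$ of elements of finite chains of $P$, that is, the geometric realization of the simplicial complex of finite nonempty chains of $P$. The simplex $\sigma$ of a chain $p_0<p_1<\dots<p_k$ is metrized by $d_\sigma(x,y)=\|\varphi_\sigma(x)-\varphi_\sigma(y)\|_2$, where $$\varphi_\sigma\Big(\sum_{i=0}^k\lambda_i p_i\Big)=\sum_{i=1}^k\lambda_i\,(e_1+e_2+\dots+e_{r[p_0,p_i]})\in\mathbb{R}^{r[p_0,p_k]}$$ and $e_1,e_2,\dots$ are the standard unit vectors. The length metric $D_2(x,y)$ on $K(P)$ is the infimum of the lengths $\sum_{i=1}^{m} d_{\sigma_i}(u_{i-1},u_i)$ of all finite paths $x=u_0,u_1,\dots,u_m=y$ in $K(P)$, where $u_{i-1}$ and $u_i$ lie in a common simplex $\sigma_i$ for each $i$. A metric space $(X,d)$ is *CAT(0)* if any two of its points are joined by a geodesic segment and,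 for every geodesic triangle with vertices $x_1,x_2,x_3$, every triangle $x_1',x_2',x_3'$ in the Euclidean plane with the same side lengths, every point $y$ on the side of the geodesic triangle joining $x_1$ and $x_2$, and the point $y'$ of the segment $[x_1',x_2']$ with $\|x_i'-y'\|=d(x_i,y)$ for $i=1,2$, one has $d(x_3,y)\le\|x_3'-y'\|$. **Theorem.** Let $M$ be a (nonempty, possibly infinite) modular lattice of finite rank, i.e. the lengths of the chains of $M$ are bounded. Then $D_2$ is a metric on $K(M)$, and $(K(M),D_2)$ is CAT(0). -/

import Mathlib

/-! ### CAT(0) spaces -/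

/-- `γ`, restricted to `[0, d(x, y)]`, is a geodesic segment joining `x` and `y`. -/
def IsGeodesicSegment {X : Type*} [MetricSpace X] (γ : ℝ → X) (x y : X) : Prop :=
  γ 0 = x ∧ γ (dist x y) = y ∧
    ∀ s ∈ Set.Icc 0 (dist x y), ∀ t ∈ Set.Icc 0 (dist x y), dist (γ s) (γ t) = |s - t|

/-- Any two points are joined by a geodesic segment. -/
def IsGeodesicSpace (X : Type*) [MetricSpace X] : Prop :=
  ∀ x y : X, ∃ γ : ℝ → X, IsGeodesicSegment γ x y

/-- A CAT(0) space: a geodesic metric space all of whose geodesic triangles satisfy the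
Cartan–Alexandrov–Toponogov comparison axiom. The triangle has vertices `x₁, x₂, x₃` and sides
`γ₁₂, γ₂₃, γ₃₁`; its comparison triangle in the Euclidean plane has vertices `x₁', x₂', x₃'`;
`y` is a point of the side `γ₁₂`, and `y'` is the corresponding point of `[x₁', x₂']`. -/
def IsCAT0 (X : Type*) [MetricSpace X] : Prop :=
  IsGeodesicSpace X ∧
    ∀ (x₁ x₂ x₃ : X) (γ₁₂ γ₂₃ γ₃₁ : ℝ → X),
      IsGeodesicSegment γ₁₂ x₁ x₂ → IsGeodesicSegment γ₂₃ x₂ x₃ → IsGeodesicSegment γ₃₁ x₃ x₁ →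
      ∀ x₁' x₂' x₃' : EuclideanSpace ℝ (Fin 2),
        dist x₁' x₂' = dist x₁ x₂ → dist x₂' x₃' = dist x₂ x₃ → dist x₃' x₁' = dist x₃ x₁ →
        ∀ y ∈ γ₁₂ '' Set.Icc 0 (dist x₁ x₂), ∀ y' ∈ segment ℝ x₁' x₂',
          dist x₁' y' = dist x₁ y → dist x₂' y' = dist x₂ y → dist x₃ y ≤ dist x₃' y'

/-! ### The orthoscheme complex -/

/-- The length `r[x, y]` of the interval `[x, y]`: the maximum length of a chain from `x` to `y`.
In a graded poset this is the length of every maximal chain from `x` to `y`. -/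
noncomputable def intervalLength {P : Type*} [PartialOrder P] (x y : P) : ℕ :=
  sSup {n : ℕ | ∃ c : LTSeries P, c.head = x ∧ c.last = y ∧ c.length = n}

/-- The points of the orthoscheme complex `K(P)`: the formal convex combinations `∑ λ_p p` of
the elements of a finite chain of `P`, that is, the points of the geometric realization of the
order complex of `P`. -/
@[ext]
structure OrthoschemeComplex (P : Type*) [PartialOrder P] where
  weight : P →₀ ℝ
  weight_nonneg : ∀ p, 0 ≤ weight p
  weight_sum : (weight.sum fun _ a => a) = 1
  isChain_support : IsChain (· ≤ ·) (weight.support : Set P)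

namespace OrthoschemeComplex

/-- The closed simplex of `K(P)` spanned by the chain `σ = (p₀ < p₁ < ⋯ < p_k)`. -/
def simplex {P : Type*} [PartialOrder P] (σ : LTSeries P) : Set (OrthoschemeComplex P) :=
  {x | (x.weight.support : Set P) ⊆ Set.range σ.toFun}

/-- The map `φ_σ`, `∑ λ_i p_i ↦ ∑ λ_i (e_1 + ⋯ + e_{r[p₀, p_i]})`, from the simplex of the chain
`σ = (p₀ < ⋯ < p_k)` into the `r[p₀, p_k]`-dimensional Euclidean space. The image is contained in
a standard orthoscheme. The term `i = 0` vanishes as `r[p₀, p₀] = 0`. -/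
noncomputable def orthoschemeMap {P : Type*} [PartialOrder P] (σ : LTSeries P)
    (x : OrthoschemeComplex P) : EuclideanSpace ℝ (Fin (intervalLength σ.head σ.last)) :=
  ∑ i : Fin (σ.length + 1), x.weight (σ.toFun i) •
    ∑ j : Fin (intervalLength σ.head σ.last) with j.val < intervalLength σ.head (σ.toFun i),
      EuclideanSpace.single j (1 : ℝ)

/-- A finite path from `x` to `y` in `K(P)`: finitely many points `u_0 = x, u_1, …, u_m = y`,
where `u_i` and `u_{i+1}` lie in the simplex of a chain `σ_i` (and are joined there by the
straight segment). -/
structure FinitePath {P : Type*} [PartialOrder P] (x y : OrthoschemeComplex P) where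
  m : ℕ
  u : Fin (m + 1) → OrthoschemeComplex P
  σ : Fin m → LTSeries P
  source : u 0 = x
  target : u (Fin.last m) = y
  left_mem : ∀ i, u i.castSucc ∈ simplex (σ i)
  right_mem : ∀ i, u i.succ ∈ simplex (σ i)

/-- The length of a finite path: the sum of the `ℓ²`-lengths of its segments. -/
noncomputable def FinitePath.length {P : Type*} [PartialOrder P] {x y : OrthoschemeComplex P}
    (w : FinitePath x y) : ENNReal :=
  ∑ i, edist (orthoschemeMap (w.σ i) (w.u i.castSucc)) (orthoschemeMap (w.σ i) (w.u i.succ))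

/-- The length metric `D₂` on `K(P)`: the infimum of the lengths of all finite paths from `x`
to `y` (`∞` if there is none). -/
noncomputable def lengthDist {P : Type*} [PartialOrder P] (x y : OrthoschemeComplex P) :
    ENNReal :=
  ⨅ w : FinitePath x y, w.length

end OrthoschemeComplex

/-! Put ⟨p, q⟩ = rk(p ∧ q) for lattice elements, extend bilinearly, and let d(x, y)² = ⟨x − y, x −
y⟩. On each simplex d is the orthoscheme metric (`dist_orthoschemeMap`). Write x = Σ (f_i − f_{i+1})
a_i and y = Σ (g_j − g_{j+1}) b_j along chains from ⊥ to ⊤. Summation by parts gives d(x, y)² = Σ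
μ_ij (f_{i+1} − g_{j+1})², where μ_ij is the mixed second difference of rk(a_i ∧ b_j), nonnegative
by modularity. So x and y are placed as in a Euclidean space with weights μ.

The point z_t at parameter t between x and y is given by the filtration H(u) = ⋁ {a_i ∧ b_j : (1 −
t) f_i + t g_j > u}, 0 ≤ u < 1. The rank of such a staircase join is a sum of μ_ij
(`latticeRank_staircaseSup`), so ⟨z_t, z_t⟩ has its Euclidean value. The join of the a_i ∧ b_j ∧ p
lies below H(u) ∧ p, hence ⟨z_t, w⟩ ≥ (1 − t)⟨x, w⟩ + t⟨y, w⟩ for every point w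
(`exists_convexCombination`). Together these give d(w, z_t)² ≤ (1 − t) d(w, x)² + t d(w, y)² − t(1 −
t) d(x, y)² (`exists_lineMap`). This one inequality, an equality in the plane, yields the triangle
inequality, the geodesics, their uniqueness and the CAT(0) comparison.

Finally d = D₂. By the triangle inequality no finite path is shorter than d. Conversely, the order
of the numbers (1 − t) f_i + t g_j changes at finitely many t only, and two points z_s, z_t with no
such change strictly between them share a simplex; so z runs along a finite path of length d(x, y).
-/

/-! ### The rank function of a modular lattice of finite rank -/

section Rank

variable {M : Type*}

/-- The rank of an element: the maximum length of a chain below it. -/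
noncomputable def latticeRank [Preorder M] (x : M) : ℕ := (Order.height x).toNat

theorem wellFoundedLT_of_finiteDimensionalOrder [Preorder M] [FiniteDimensionalOrder M] :
    WellFoundedLT M :=
  ⟨SetRel.IsWellFounded.of_finiteDimensional (r := {(a, b) : M × M | a < b})⟩

theorem wellFoundedGT_of_finiteDimensionalOrder [Preorder M] [FiniteDimensionalOrder M] :
    WellFoundedGT M :=
  ⟨SetRel.IsWellFounded.inv_of_finiteDimensional (r := {(a, b) : M × M | a < b})⟩

theorem height_lt_top_of_finiteDimensionalOrder [Preorder M] [FiniteDimensionalOrder M] (x : M) :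
    Order.height x < ⊤ := by
  refine lt_of_le_of_lt (Order.height_le (n := (LTSeries.longestOf M).length) ?_)
    (ENat.natCast_lt_top _)
  intro p _
  exact_mod_cast p.longestOf_is_longest

theorem coe_latticeRank [Preorder M] [FiniteDimensionalOrder M] (x : M) :
    (latticeRank x : ℕ∞) = Order.height x :=
  ENat.natCast_toNat (height_lt_top_of_finiteDimensionalOrder x).ne

theorem latticeRank_strictMono [Preorder M] [FiniteDimensionalOrder M] :
    StrictMono (latticeRank : M → ℕ) := by
  intro x y h
  have := Order.height_strictMono h (height_lt_top_of_finiteDimensionalOrder x)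
  rw [← coe_latticeRank, ← coe_latticeRank] at this
  exact_mod_cast this

theorem latticeRank_mono [PartialOrder M] [FiniteDimensionalOrder M] :
    Monotone (latticeRank : M → ℕ) :=
  latticeRank_strictMono.monotone

theorem latticeRank_bot [Preorder M] [OrderBot M] : latticeRank (⊥ : M) = 0 := by
  simp [latticeRank]

theorem exists_lt_latticeRank_eq [Preorder M] [FiniteDimensionalOrder M] {y : M} {n : ℕ}
    (h : latticeRank y = n + 1) : ∃ z < y, latticeRank z = n := by
  have h' : Order.height y = (n : ℕ∞) + 1 := by rw [← coe_latticeRank, h]; push_cast; rfl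
  obtain ⟨-, ⟨z, hz, hn⟩, -⟩ := Order.height_eq_coe_add_one_iff.1 h'
  refine ⟨z, hz, ?_⟩
  rw [← coe_latticeRank] at hn
  exact_mod_cast hn

theorem LTSeries.latticeRank_head_add_length_le [Preorder M] [FiniteDimensionalOrder M]
    (c : LTSeries M) :
    latticeRank c.head + c.length ≤ latticeRank c.last :=
  (c.map latticeRank latticeRank_strictMono).head_add_length_le_nat

variable [Lattice M] [IsModularLattice M] [FiniteDimensionalOrder M]

/-- Some `z` below `y` has rank one less. If `z` differs from `x`, both are lower covers of `y`, so
by modularity both cover `x ⊓ z`, and induction gives them the same rank. -/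
theorem CovBy.latticeRank_eq {x y : M} (h : x ⋖ y) : latticeRank y = latticeRank x + 1 := by
  induction hn : latticeRank y using Nat.strong_induction_on generalizing x y with
  | _ n ih =>
    have hlt := latticeRank_strictMono h.lt
    obtain ⟨m, rfl⟩ : ∃ m, n = m + 1 := ⟨n - 1, by omega⟩
    obtain ⟨z, hzy, hz⟩ := exists_lt_latticeRank_eq hn
    by_cases hzx : z ≤ x
    · have := latticeRank_mono hzx
      omega
    have hcov : z ⋖ y := by
      refine ⟨hzy, fun w hzw hwy => ?_⟩
      have h1 := latticeRank_strictMono hzw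
      have h2 := latticeRank_strictMono hwy
      omega
    have hsup : x ⊔ z = y := by
      rcases h.eq_or_eq le_sup_left (sup_le h.le hcov.le) with h1 | h1
      · exact absurd (h1 ▸ le_sup_right) hzx
      · exact h1
    have h1 : x ⊓ z ⋖ z := inf_covBy_of_covBy_sup_left (by rwa [hsup])
    have h2 : x ⊓ z ⋖ x := inf_covBy_of_covBy_sup_right (by rwa [hsup])
    have h3 := ih _ (by omega) h1 rfl
    have h4 := ih _ (by omega) h2 rfl
    omega

/-- Replace `x` by a lower cover `z` above `x ⊓ y`: the meet with `y` is unchanged, and by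
modularity `x ⊔ y` covers `z ⊔ y`, so both sides drop by one. -/
theorem latticeRank_sup_add_latticeRank_inf (x y : M) :
    latticeRank (x ⊔ y) + latticeRank (x ⊓ y) = latticeRank x + latticeRank y := by
  have := wellFoundedLT_of_finiteDimensionalOrder (M := M)
  have := wellFoundedGT_of_finiteDimensionalOrder (M := M)
  induction x using WellFoundedLT.induction with
  | _ x ih =>
    by_cases hxy : x ≤ y
    · rw [sup_eq_right.2 hxy, inf_eq_left.2 hxy, add_comm]
    have hlt : x ⊓ y < x := lt_of_le_not_ge inf_le_left fun h => hxy (h.trans inf_le_right)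
    obtain ⟨z, hz, hcov⟩ := exists_le_covBy_of_lt hlt
    have h1 : z ⊓ y = x ⊓ y := le_antisymm (inf_le_inf_right y hcov.le) (le_inf hz inf_le_right)
    have h2 : x ⊓ (z ⊔ y) = z := by
      rw [inf_comm, sup_inf_assoc_of_le y hcov.le, inf_comm y x, sup_eq_left.2 hz]
    have h3 : z ⊔ y ⋖ x ⊔ (z ⊔ y) := covBy_sup_of_inf_covBy_left (by rwa [h2])
    have h4 : x ⊔ (z ⊔ y) = x ⊔ y := by rw [← sup_assoc, sup_eq_left.2 hcov.le]
    have h5 := ih z hcov.lt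
    have h6 := h3.latticeRank_eq
    have h7 := hcov.latticeRank_eq
    rw [h1] at h5
    rw [h4] at h6
    omega

theorem exists_ltSeries_of_le {x y : M} (h : x ≤ y) :
    ∃ c : LTSeries M, c.head = x ∧ c.last = y ∧ latticeRank x + c.length = latticeRank y := by
  have := wellFoundedLT_of_finiteDimensionalOrder (M := M)
  have := wellFoundedGT_of_finiteDimensionalOrder (M := M)
  induction y using WellFoundedLT.induction with
  | _ y ih =>
    rcases h.eq_or_lt with rfl | hlt
    · exact ⟨RelSeries.singleton _ x, rfl, rfl, rfl⟩
    obtain ⟨z, hz, hcov⟩ := exists_le_covBy_of_lt hlt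
    obtain ⟨c, hc, hl, hr⟩ := ih z hcov.lt hz
    refine ⟨c.snoc y (by rw [hl]; exact hcov.lt), by simpa using hc, by simp, ?_⟩
    have := hcov.latticeRank_eq
    simp only [RelSeries.snoc_length]
    omega

theorem latticeRank_add_intervalLength {x y : M} (h : x ≤ y) :
    latticeRank x + intervalLength x y = latticeRank y := by
  obtain ⟨c, hc, hl, hr⟩ := exists_ltSeries_of_le h
  have : intervalLength x y = c.length := by
    refine IsGreatest.csSup_eq ⟨⟨c, hc, hl, rfl⟩, ?_⟩
    rintro n ⟨c', rfl, rfl, rfl⟩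
    have := c'.latticeRank_head_add_length_le
    omega
  omega

end Rank

/-! ### Joins of staircases of meets of two chains -/

section Staircase

open Finset

/-- The mixed second difference of a function of two indices. -/
def mixedDiff (K : ℕ → ℕ → ℝ) (i j : ℕ) : ℝ :=
  K (i + 1) (j + 1) - K i (j + 1) - K (i + 1) j + K i j

theorem sum_range_mixedDiff_right {K : ℕ → ℕ → ℝ} (hK : ∀ i, K i 0 = 0) (i n : ℕ) :
    ∑ j ∈ range n, mixedDiff K i j = K (i + 1) n - K i n := by
  induction n with
  | zero => simp [hK]
  | succ n ih => rw [sum_range_succ, ih, mixedDiff]; ring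

theorem sum_range_mixedDiff_left {K : ℕ → ℕ → ℝ} (hK : ∀ j, K 0 j = 0) (m j : ℕ) :
    ∑ i ∈ range m, mixedDiff K i j = K m (j + 1) - K m j := by
  induction m with
  | zero => simp [hK]
  | succ n ih => rw [sum_range_succ, ih, mixedDiff]; ring

/-! ### Summation by parts. -/

theorem sum_range_sub_mul_eq (f w : ℕ → ℝ) (m : ℕ) :
    ∑ i ∈ range (m + 1), (f i - f (i + 1)) * w i =
      f 0 * w 0 + ∑ i ∈ range m, f (i + 1) * (w (i + 1) - w i) - f (m + 1) * w m := by
  induction m with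
  | zero => simp; ring
  | succ m ih => rw [sum_range_succ, ih, sum_range_succ]; ring

theorem sum_range_sub_mul {f w : ℕ → ℝ} {m : ℕ} (hf : f (m + 1) = 0) (hw : w 0 = 0) :
    ∑ i ∈ range (m + 1), (f i - f (i + 1)) * w i =
      ∑ i ∈ range m, f (i + 1) * (w (i + 1) - w i) := by
  rw [sum_range_sub_mul_eq, hf, hw]; ring

theorem sum_range_sub_mul_sub_mul {f g : ℕ → ℝ} {K : ℕ → ℕ → ℝ} {m n : ℕ} (hf : f (m + 1) = 0)
    (hg : g (n + 1) = 0) (hK₁ : ∀ j, K 0 j = 0) (hK₂ : ∀ i, K i 0 = 0) :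
    ∑ i ∈ range (m + 1), ∑ j ∈ range (n + 1), (f i - f (i + 1)) * (g j - g (j + 1)) * K i j =
      ∑ i ∈ range m, ∑ j ∈ range n, f (i + 1) * g (j + 1) * mixedDiff K i j := by
  have h1 : ∀ i, ∑ j ∈ range (n + 1), (f i - f (i + 1)) * (g j - g (j + 1)) * K i j =
      (f i - f (i + 1)) * ∑ j ∈ range n, g (j + 1) * (K i (j + 1) - K i j) := by
    intro i
    rw [← sum_range_sub_mul hg (hK₂ i), mul_sum]
    exact sum_congr rfl fun j _ => by ring
  simp only [h1]
  rw [sum_range_sub_mul hf (by simp [hK₁])]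
  refine sum_congr rfl fun i _ => ?_
  rw [← sum_sub_distrib, mul_sum]
  exact sum_congr rfl fun j _ => by rw [mixedDiff]; ring

theorem sum_range_ite_lt {k m : ℕ} (h : k ≤ m) (w : ℕ → ℝ) :
    ∑ i ∈ range m, (if i < k then w i else 0) = ∑ i ∈ range k, w i := by
  rw [← sum_filter]
  congr 1
  ext i
  simp only [mem_filter, mem_range]
  omega

variable {M : Type*} [Lattice M]

/-- The ranks of the meets of the elements of two sequences. -/
noncomputable def meetRank (a b : ℕ → M) (i j : ℕ) : ℝ := latticeRank (a i ⊓ b j)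

open Classical in
/-- The join of the meets `a i ⊓ b j` with `i ≤ m`, `j ≤ n` and `S i j`. -/
noncomputable def staircaseSup [OrderBot M] (a b : ℕ → M) (S : ℕ → ℕ → Prop) (m n : ℕ) : M :=
  ((range (m + 1) ×ˢ range (n + 1)).filter fun x => S x.1 x.2).sup fun x => a x.1 ⊓ b x.2

theorem staircaseSup_le_iff [OrderBot M] {a b : ℕ → M} {S : ℕ → ℕ → Prop} {m n : ℕ} {z : M} :
    staircaseSup a b S m n ≤ z ↔ ∀ i ≤ m, ∀ j ≤ n, S i j → a i ⊓ b j ≤ z := by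
  simp only [staircaseSup, Finset.sup_le_iff, mem_filter, mem_product, mem_range, Prod.forall,
    Nat.lt_succ_iff]
  exact ⟨fun h i hi j hj hS => h i j ⟨⟨hi, hj⟩, hS⟩, fun h i j hS => h i hS.1.1 j hS.1.2 hS.2⟩

theorem le_staircaseSup [OrderBot M] {a b : ℕ → M} {S : ℕ → ℕ → Prop} {m n i j : ℕ}
    (hi : i ≤ m) (hj : j ≤ n) (h : S i j) : a i ⊓ b j ≤ staircaseSup a b S m n :=
  staircaseSup_le_iff.1 le_rfl i hi j hj h

theorem staircaseSup_mono [OrderBot M] {a b : ℕ → M} {S T : ℕ → ℕ → Prop} {m n : ℕ}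
    (h : ∀ i j, S i j → T i j) : staircaseSup a b S m n ≤ staircaseSup a b T m n :=
  staircaseSup_le_iff.2 fun _ hi _ hj hS => le_staircaseSup hi hj (h _ _ hS)

/-- Equality may fail for lack of distributivity; this inequality is the source of nonpositive
curvature. -/
theorem staircaseSup_inf_le [OrderBot M] (a b : ℕ → M) (S : ℕ → ℕ → Prop) (m n : ℕ) (p : M) :
    staircaseSup (fun i => a i ⊓ p) (fun j => b j ⊓ p) S m n ≤ staircaseSup a b S m n ⊓ p :=
  staircaseSup_le_iff.2 fun _ hi _ hj h => le_inf
    ((inf_le_inf inf_le_left inf_le_left).trans (le_staircaseSup hi hj h))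
    (inf_le_left.trans inf_le_right)

theorem meetRank_zero_left [OrderBot M] {a b : ℕ → M} (ha : a 0 = ⊥) (j : ℕ) :
    meetRank a b 0 j = 0 := by
  simp [meetRank, ha, latticeRank_bot]

theorem meetRank_zero_right [OrderBot M] {a b : ℕ → M} (hb : b 0 = ⊥) (i : ℕ) :
    meetRank a b i 0 = 0 := by
  simp [meetRank, hb, latticeRank_bot]

/-- The two middle meets lie below `a (i + 1) ⊓ b (j + 1)` and intersect in `a i ⊓ b j`, so the rank
law for their join gives the sign. -/
theorem mixedDiff_meetRank_nonneg [IsModularLattice M] [FiniteDimensionalOrder M] {a b : ℕ → M}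
    (ha : Monotone a) (hb : Monotone b) (i j : ℕ) : 0 ≤ mixedDiff (meetRank a b) i j := by
  have h := latticeRank_sup_add_latticeRank_inf (a i ⊓ b (j + 1)) (a (i + 1) ⊓ b j)
  have hi := ha i.le_succ
  have hj := hb j.le_succ
  have h1 : a i ⊓ b (j + 1) ⊓ (a (i + 1) ⊓ b j) = a i ⊓ b j := by
    rw [inf_inf_inf_comm, inf_eq_left.2 hi, inf_eq_right.2 hj]
  have h2 : a i ⊓ b (j + 1) ⊔ a (i + 1) ⊓ b j ≤ a (i + 1) ⊓ b (j + 1) :=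
    sup_le (inf_le_inf_right _ hi) (inf_le_inf_left _ hj)
  have h3 := latticeRank_mono h2
  rw [h1] at h
  simp only [mixedDiff, meetRank]
  have h4 : (latticeRank (a i ⊓ b (j + 1)) + latticeRank (a (i + 1) ⊓ b j) : ℝ) ≤
      latticeRank (a (i + 1) ⊓ b (j + 1)) + latticeRank (a i ⊓ b j) := by
    exact_mod_cast (by omega)
  linarith

-- Induction on `n`. Of the new meets only the largest, `a k ⊓ b (n + 1)`, matters; it meets the old
-- join exactly in `a k ⊓ b n`, so the modular rank law gives the increment and no distributivity is
-- needed.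
open Classical in
theorem latticeRank_staircaseSup [IsModularLattice M] [FiniteDimensionalOrder M] [OrderBot M]
    {a b : ℕ → M} (ha : Monotone a) (hb : Monotone b) (ha₀ : a 0 = ⊥) (hb₀ : b 0 = ⊥)
    {S : ℕ → ℕ → Prop} (hS : ∀ i j i' j', i' ≤ i → j' ≤ j → S i j → S i' j') (m n : ℕ) :
    (latticeRank (staircaseSup a b S m n) : ℝ) = ∑ i ∈ range m, ∑ j ∈ range n,
      if S (i + 1) (j + 1) then mixedDiff (meetRank a b) i j else 0 := by
  induction n with
  | zero =>
    have : staircaseSup a b S m 0 = ⊥ := le_bot_iff.1 <| staircaseSup_le_iff.2 fun i _ j hj _ => by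
      obtain rfl : j = 0 := by omega
      simp [hb₀]
    simp [this, latticeRank_bot]
  | succ n ih =>
    -- If no index qualifies, `k = 0`, and `a 0 = ⊥` makes the new contribution vanish.
    let k := Nat.findGreatest (fun i => S i (n + 1)) m
    have hk : k ≤ m := Nat.findGreatest_le m
    have hle : ∀ i ≤ m, S i (n + 1) → i ≤ k := fun i hi h => Nat.le_findGreatest hi h
    have hkS : k ≠ 0 → S k (n + 1) := fun h =>
      Nat.findGreatest_of_ne_zero (P := fun i => S i (n + 1)) rfl h
    have hiff : ∀ i ∈ range m, (S (i + 1) (n + 1) ↔ i < k) := fun i hi =>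
      ⟨fun h => hle (i + 1) (by simpa using hi) h, fun h =>
        hS k (n + 1) _ _ h le_rfl (hkS (by omega))⟩
    have hsum : ∑ i ∈ range m, (if S (i + 1) (n + 1) then mixedDiff (meetRank a b) i n else 0) =
        meetRank a b k (n + 1) - meetRank a b k n := by
      rw [← sum_range_mixedDiff_left (meetRank_zero_left ha₀), ← sum_range_ite_lt hk]
      exact sum_congr rfl fun i hi => by rw [if_congr (hiff i hi) rfl rfl]
    have hsup : staircaseSup a b S m (n + 1) = staircaseSup a b S m n ⊔ a k ⊓ b (n + 1) := by
      refine le_antisymm (staircaseSup_le_iff.2 fun i hi j hj h => ?_)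
        (sup_le (staircaseSup_le_iff.2 fun i hi j hj h => le_staircaseSup hi (by omega) h) ?_)
      · rcases Nat.lt_or_ge n j with hj' | hj'
        · obtain rfl : j = n + 1 := by omega
          exact (inf_le_inf_right _ (ha (hle i hi h))).trans le_sup_right
        · exact (le_staircaseSup hi hj' h).trans le_sup_left
      · by_cases hk0 : k = 0
        · simp [hk0, ha₀]
        · exact le_staircaseSup hk le_rfl (hkS hk0)
    -- The old join lies below `b n`, and `a k ⊓ b n` is one of its terms because `S` is closed
    -- downwards.
    have hinf : staircaseSup a b S m n ⊓ (a k ⊓ b (n + 1)) = a k ⊓ b n := by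
      refine le_antisymm (le_inf (inf_le_right.trans inf_le_left) (inf_le_left.trans
        (staircaseSup_le_iff.2 fun i hi j hj h => inf_le_right.trans (hb hj))))
        (le_inf ?_ (inf_le_inf_left _ (hb n.le_succ)))
      by_cases hk0 : k = 0
      · simp [hk0, ha₀]
      · exact le_staircaseSup hk le_rfl (hS k (n + 1) _ _ le_rfl n.le_succ (hkS hk0))
    have h := latticeRank_sup_add_latticeRank_inf (staircaseSup a b S m n) (a k ⊓ b (n + 1))
    rw [← hsup, hinf] at h
    have h' : (latticeRank (staircaseSup a b S m (n + 1)) : ℝ) + meetRank a b k n =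
        latticeRank (staircaseSup a b S m n) + meetRank a b k (n + 1) := by
      simp only [meetRank]
      exact_mod_cast h
    simp only [sum_range_succ, sum_add_distrib, hsum, ← ih]
    linarith

end Staircase

/-! ### Chains and series -/

section Chain

theorem exists_ltSeries_range_eq {P : Type*} [PartialOrder P] {C : Finset P} (hne : C.Nonempty)
    (hC : IsChain (· ≤ ·) (C : Set P)) : ∃ σ : LTSeries P, Set.range σ.toFun = C := by
  classical
  induction hn : C.card generalizing C with
  | zero => simp [Finset.card_eq_zero.1 hn] at hne
  | succ n ih =>
    obtain ⟨p, hp⟩ := C.exists_maximal hne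
    rcases (C.erase p).eq_empty_or_nonempty with h | h
    · refine ⟨RelSeries.singleton _ p, ?_⟩
      have : C = {p} := by rw [← Finset.insert_erase hp.prop, h]; rfl
      simp only [this, Finset.coe_singleton, Set.range_eq_singleton_iff]
      exact fun _ => rfl
    · obtain ⟨σ, hσ⟩ := ih h (hC.mono (by simp))
        (by rw [Finset.card_erase_of_mem hp.prop, hn]; rfl)
      have hl : σ.last ∈ C.erase p := by
        have : σ.last ∈ Set.range σ.toFun := ⟨_, rfl⟩
        rw [hσ] at this
        exact_mod_cast this
      rw [Finset.mem_erase] at hl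
      have hlt : σ.last < p := by
        refine lt_of_le_of_ne ?_ hl.1
        rcases hC hl.2 hp.prop hl.1 with h | h
        · exact h
        · exact hp.le_of_ge hl.2 h
      refine ⟨σ.snoc p hlt, ?_⟩
      ext x
      have h1 : x ∈ Set.range (σ.snoc p hlt).toFun ↔ x ∈ Set.range σ.toFun ∨ x = p :=
        RelSeries.mem_snoc
      rw [h1, hσ]
      by_cases hx : x = p
      · simpa [hx] using hp.prop
      · simp [hx]

end Chain

/-! ### The scalar product of two points of the orthoscheme complex -/

namespace OrthoschemeComplex

open Finset

variable {M : Type*} [Lattice M]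

/-- The symmetric bilinear form on formal linear combinations of lattice elements whose value at
two elements is the rank of their meet. -/
noncomputable def rankForm : (M →₀ ℝ) →ₗ[ℝ] (M →₀ ℝ) →ₗ[ℝ] ℝ :=
  Finsupp.linearCombination ℝ fun p =>
    Finsupp.linearCombination ℝ fun q => (latticeRank (p ⊓ q) : ℝ)

theorem rankForm_single_single (p q : M) (s t : ℝ) :
    rankForm (Finsupp.single p s) (Finsupp.single q t) = s * t * latticeRank (p ⊓ q) := by
  simp [rankForm, mul_assoc]

theorem rankForm_eq_sum (v w : M →₀ ℝ) :
    rankForm v w = ∑ p ∈ v.support, ∑ q ∈ w.support, v p * w q * latticeRank (p ⊓ q) := by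
  simp only [rankForm, Finsupp.linearCombination_apply, Finsupp.sum, LinearMap.sum_apply,
    LinearMap.smul_apply, smul_eq_mul, mul_sum, mul_assoc]

theorem rankForm_comm (v w : M →₀ ℝ) : rankForm v w = rankForm w v := by
  rw [rankForm_eq_sum, rankForm_eq_sum, sum_comm]
  exact sum_congr rfl fun p _ => sum_congr rfl fun q _ => by rw [inf_comm]; ring

/-- The square of the distance between two points. -/
noncomputable def sqDist (x y : OrthoschemeComplex M) : ℝ :=
  rankForm (x.weight - y.weight) (x.weight - y.weight)

theorem sqDist_eq (x y : OrthoschemeComplex M) :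
    sqDist x y = rankForm x.weight x.weight + rankForm y.weight y.weight -
      2 * rankForm x.weight y.weight := by
  simp only [sqDist, map_sub, LinearMap.sub_apply]
  rw [rankForm_comm y.weight x.weight]
  ring

theorem sqDist_comm (x y : OrthoschemeComplex M) : sqDist x y = sqDist y x := by
  rw [sqDist_eq, sqDist_eq, rankForm_comm x.weight y.weight]
  ring

theorem sqDist_self (x : OrthoschemeComplex M) : sqDist x x = 0 := by
  simp [sqDist]

/-- The vertex of the orthoscheme complex at a lattice element. -/
noncomputable def vertex {P : Type*} [PartialOrder P] (p : P) : OrthoschemeComplex P where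
  weight := Finsupp.single p 1
  weight_nonneg q := by
    classical
    rw [Finsupp.single_apply]
    split_ifs <;> simp
  weight_sum := by simp
  isChain_support := by
    rw [Finsupp.support_single p one_ne_zero, coe_singleton]
    exact Set.subsingleton_singleton.isChain

/-- The point `x` is `∑ (f i - f (i + 1)) a i`, where `⊥ = a 0 ≤ a 1 ≤ ⋯ ≤ a m = ⊤` and
`1 = f 0 ≥ f 1 ≥ ⋯ ≥ f (m + 1) = 0`. -/
structure IsFlag [BoundedOrder M] (x : OrthoschemeComplex M) (m : ℕ) (a : ℕ → M) (f : ℕ → ℝ) :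
    Prop where
  mono : Monotone a
  zero : a 0 = ⊥
  top : a m = ⊤
  anti : Antitone f
  f_zero : f 0 = 1
  f_succ : f (m + 1) = 0
  weight_eq : x.weight = ∑ i ∈ range (m + 1), Finsupp.single (a i) (f i - f (i + 1))

theorem sum_weight_eq_one {P : Type*} [PartialOrder P] (x : OrthoschemeComplex P) {C : Finset P}
    (hC : x.weight.support ⊆ C) : ∑ p ∈ C, x.weight p = 1 := by
  rw [← x.weight_sum, Finsupp.sum_of_support_subset _ hC _ (by simp)]

/-- The support is enlarged by `⊥` and `⊤`, possibly with weight zero, so that boundary terms vanish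
at `⊥` and sums telescope up to `⊤`. -/
theorem exists_isFlag [BoundedOrder M] (x : OrthoschemeComplex M) :
    ∃ m a f, x.IsFlag m a f := by
  classical
  let C : Finset M := insert ⊥ (insert ⊤ x.weight.support)
  have hC : IsChain (· ≤ ·) (C : Set M) := by
    rw [coe_insert, coe_insert]
    exact (x.isChain_support.insert fun b _ _ => Or.inr le_top).insert fun b _ _ => Or.inl bot_le
  obtain ⟨σ, hσ⟩ := exists_ltSeries_range_eq (insert_nonempty _ _) hC
  have hmem : ∀ p, p ∈ C ↔ ∃ i, σ i = p := fun p => by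
    rw [← mem_coe, ← hσ]; rfl
  let m := σ.length
  let a : ℕ → M := fun i => σ ⟨min i m, by omega⟩
  -- Tail sums, whose consecutive differences are the weights.
  let f : ℕ → ℝ := fun i => ∑ k ∈ Ico i (m + 1), x.weight (a k)
  have hsub : ∀ i ∈ range (m + 1), f i - f (i + 1) = x.weight (a i) := fun i hi => by
    simp only [f]
    rw [sum_eq_sum_Ico_succ_bot (by simpa using hi)]
    ring
  have hmono : Monotone a := fun i j hij => σ.monotone (by simp only [Fin.mk_le_mk]; omega)
  have himage : (range (m + 1)).image a = C := by
    ext p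
    rw [hmem, mem_image]
    constructor
    · rintro ⟨i, -, rfl⟩
      exact ⟨_, rfl⟩
    · rintro ⟨i, rfl⟩
      refine ⟨i, by simpa [m] using Nat.lt_succ_iff.1 i.2, ?_⟩
      simp only [a]
      congr 1
      ext
      simp [m, Nat.lt_succ_iff.1 i.2]
  have hinj : Set.InjOn a (range (m + 1)) := fun i hi j hj hij => by
    have := σ.strictMono.injective hij
    simp only [coe_range, Set.mem_Iio, Fin.mk.injEq] at this hi hj
    omega
  have hsupp : x.weight.support ⊆ C := (subset_insert _ _).trans (subset_insert _ _)
  refine ⟨m, a, f, hmono, ?_, ?_, ?_, ?_, by simp [f], ?_⟩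
  · obtain ⟨i, hi⟩ := (hmem ⊥).1 (by simp [C])
    exact le_bot_iff.1 (hi ▸ σ.monotone (by simp))
  · obtain ⟨i, hi⟩ := (hmem ⊤).1 (by simp [C])
    exact top_le_iff.1 (hi ▸ σ.monotone (by simp only [Fin.le_def]; omega))
  · intro i j hij
    exact sum_le_sum_of_subset_of_nonneg (Ico_subset_Ico_left hij) fun _ _ _ => x.weight_nonneg _
  · rw [← x.sum_weight_eq_one hsupp, ← himage, sum_image hinj]
    simp [f]
  · rw [sum_congr rfl fun i hi => by rw [hsub i hi], ← sum_image (f := fun p =>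
      Finsupp.single p (x.weight p)) hinj, himage]
    conv_lhs => rw [← Finsupp.sum_single x.weight]
    exact Finsupp.sum_of_support_subset _ hsupp _ (by simp)

namespace IsFlag

variable [BoundedOrder M] {x y : OrthoschemeComplex M} {m n : ℕ} {a b : ℕ → M} {f g : ℕ → ℝ}

theorem nonneg (hx : x.IsFlag m a f) {i : ℕ} (hi : i ≤ m + 1) : 0 ≤ f i :=
  hx.f_succ ▸ hx.anti hi

theorem le_one (hx : x.IsFlag m a f) (i : ℕ) : f i ≤ 1 :=
  hx.f_zero ▸ hx.anti i.zero_le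

theorem rankForm_single (hx : x.IsFlag m a f) (p : M) :
    rankForm x.weight (Finsupp.single p 1) = ∑ i ∈ range m,
      f (i + 1) * ((latticeRank (a (i + 1) ⊓ p) : ℝ) - latticeRank (a i ⊓ p)) := by
  rw [← sum_range_sub_mul (w := fun i => (latticeRank (a i ⊓ p) : ℝ)) hx.f_succ
    (by simp [hx.zero, latticeRank_bot]), hx.weight_eq]
  simp only [map_sum, LinearMap.sum_apply, rankForm_single_single, mul_one]

theorem rankForm_eq (hx : x.IsFlag m a f) (hy : y.IsFlag n b g) :
    rankForm x.weight y.weight = ∑ i ∈ range m, ∑ j ∈ range n,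
      mixedDiff (meetRank a b) i j * (f (i + 1) * g (j + 1)) := by
  have h := sum_range_sub_mul_sub_mul hx.f_succ hy.f_succ (meetRank_zero_left (b := b) hx.zero)
    (meetRank_zero_right (a := a) hy.zero)
  rw [sum_congr rfl fun i _ => sum_congr rfl fun j _ => mul_comm _ _, ← h,
    hx.weight_eq, hy.weight_eq]
  simp only [map_sum, LinearMap.sum_apply, rankForm_single_single, meetRank]
  exact sum_comm

/-- Along a single chain the rank of a meet is that of the lower element, so the mixed difference
vanishes off the diagonal. -/
theorem rankForm_self (hx : x.IsFlag m a f) :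
    rankForm x.weight x.weight = ∑ i ∈ range m,
      ((latticeRank (a (i + 1)) : ℝ) - latticeRank (a i)) * f (i + 1) ^ 2 := by
  have hmin : ∀ i j, i ≤ j → a i ⊓ a j = a i := fun i j h => inf_eq_left.2 (hx.mono h)
  rw [hx.rankForm_eq hx]
  refine sum_congr rfl fun i hi => ?_
  rw [sum_eq_single_of_mem i hi]
  · simp only [mixedDiff, meetRank]
    rw [hmin _ _ le_rfl, hmin _ _ i.le_succ, hmin _ _ le_rfl, inf_comm, hmin _ _ i.le_succ]
    ring
  · intro j _ hj
    have : mixedDiff (meetRank a a) i j = 0 := by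
      simp only [mixedDiff, meetRank]
      rcases Nat.lt_or_gt_of_ne hj with h | h
      · rw [inf_comm, hmin _ _ (by omega), inf_comm, hmin _ _ (by omega), inf_comm,
          hmin _ _ (by omega), inf_comm, hmin _ _ (by omega)]
        ring
      · rw [hmin _ _ (by omega), hmin _ _ (by omega), hmin _ _ (by omega), hmin _ _ (by omega)]
        ring
    rw [this, zero_mul]

/-- The row sums telescope from `b 0 = ⊥` to `b n = ⊤`. With `p = ⊤` this turns the norm of one
point into a sum over both flags; general `p` serves the pairing with a vertex. -/
theorem sum_mixedDiff_right (hy : y.IsFlag n b g) (a : ℕ → M) (m : ℕ) (p : M) (w : ℕ → ℝ) :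
    ∑ i ∈ range m, ∑ j ∈ range n,
      mixedDiff (meetRank (fun i => a i ⊓ p) fun j => b j ⊓ p) i j * w i =
      ∑ i ∈ range m, ((latticeRank (a (i + 1) ⊓ p) : ℝ) - latticeRank (a i ⊓ p)) * w i := by
  refine sum_congr rfl fun i _ => ?_
  rw [← sum_mul, sum_range_mixedDiff_right (meetRank_zero_right (by simp [hy.zero]))]
  simp [meetRank, hy.top]

theorem sum_mixedDiff_left (hx : x.IsFlag m a f) (b : ℕ → M) (n : ℕ) (p : M) (w : ℕ → ℝ) :
    ∑ i ∈ range m, ∑ j ∈ range n,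
      mixedDiff (meetRank (fun i => a i ⊓ p) fun j => b j ⊓ p) i j * w j =
      ∑ j ∈ range n, ((latticeRank (b (j + 1) ⊓ p) : ℝ) - latticeRank (b j ⊓ p)) * w j := by
  rw [sum_comm]
  refine sum_congr rfl fun i _ => ?_
  rw [← sum_mul, sum_range_mixedDiff_left (meetRank_zero_left (by simp [hx.zero]))]
  simp [meetRank, hx.top, inf_comm]

theorem rankForm_self_left (hx : x.IsFlag m a f) (hy : y.IsFlag n b g) :
    rankForm x.weight x.weight = ∑ i ∈ range m, ∑ j ∈ range n,
      mixedDiff (meetRank a b) i j * f (i + 1) ^ 2 := by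
  have h := hy.sum_mixedDiff_right a m ⊤ fun i => f (i + 1) ^ 2
  simp only [inf_top_eq] at h
  rw [hx.rankForm_self, ← h]

theorem rankForm_self_right (hx : x.IsFlag m a f) (hy : y.IsFlag n b g) :
    rankForm y.weight y.weight = ∑ i ∈ range m, ∑ j ∈ range n,
      mixedDiff (meetRank a b) i j * g (j + 1) ^ 2 := by
  have h := hx.sum_mixedDiff_left b n ⊤ fun j => g (j + 1) ^ 2
  simp only [inf_top_eq] at h
  rw [hy.rankForm_self, ← h]

end IsFlag

/-- In terms of two flags the squared distance is the sum of the squares `(f (i + 1) - g (j + 1)) ^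
2` with nonnegative weights. -/
theorem sqDist_nonneg [BoundedOrder M] [IsModularLattice M] [FiniteDimensionalOrder M]
    (x y : OrthoschemeComplex M) : 0 ≤ sqDist x y := by
  obtain ⟨m, a, f, hx⟩ := x.exists_isFlag
  obtain ⟨n, b, g, hy⟩ := y.exists_isFlag
  rw [sqDist_eq, hx.rankForm_self_left hy, hx.rankForm_self_right hy, hx.rankForm_eq hy]
  simp only [mul_sum, ← sum_add_distrib, ← sum_sub_distrib]
  refine sum_nonneg fun i _ => sum_nonneg fun j _ => ?_
  have := mul_nonneg (mixedDiff_meetRank_nonneg hx.mono hy.mono i j)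
    (sq_nonneg (f (i + 1) - g (j + 1)))
  nlinarith

end OrthoschemeComplex

/-! ### Points given by filtrations, and convex combinations -/

section Filtration

open MeasureTheory Set

variable {M : Type*}

theorem Antitone.measurableSet_preimage_singleton [PartialOrder M] {H : ℝ → M} (hH : Antitone H)
    (p : M) : MeasurableSet (H ⁻¹' {p}) :=
  (ordConnected_singleton.preimage_anti hH).measurableSet

theorem comp_eq_sum_indicator {H : ℝ → M} {V : Finset M} (hV : range H ⊆ V) (w : M → ℝ) :
    (fun u => w (H u)) = fun u => ∑ p ∈ V, (H ⁻¹' {p}).indicator (fun _ => w p) u := by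
  funext u
  rw [Finset.sum_eq_single_of_mem (H u) (by exact_mod_cast hV ⟨u, rfl⟩)]
  · simp
  · intro p _ hp
    exact indicator_of_notMem (by simpa using hp.symm) _

theorem integrableOn_comp_of_antitone [PartialOrder M] {H : ℝ → M} (hH : Antitone H)
    (hf : (range H).Finite) (w : M → ℝ) : IntegrableOn (fun u => w (H u)) (Ico 0 1) := by
  rw [comp_eq_sum_indicator (V := hf.toFinset) (by simp) w]
  exact integrable_finsetSum _ fun p _ =>
    (integrable_const _).indicator (hH.measurableSet_preimage_singleton p)

theorem setIntegral_comp_of_antitone [PartialOrder M] {H : ℝ → M} (hH : Antitone H)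
    {V : Finset M} (hV : range H ⊆ V) (w : M → ℝ) :
    ∫ u in Ico 0 1, w (H u) = ∑ p ∈ V, volume.real (Ico 0 1 ∩ H ⁻¹' {p}) * w p := by
  rw [comp_eq_sum_indicator hV w, integral_finsetSum _ fun p _ =>
    (integrable_const _).indicator (hH.measurableSet_preimage_singleton p)]
  refine Finset.sum_congr rfl fun p _ => ?_
  rw [integral_indicator_const _ (hH.measurableSet_preimage_singleton p), smul_eq_mul,
    measureReal_restrict_apply (hH.measurableSet_preimage_singleton p), inter_comm]

theorem setIntegral_Ico_ite_lt {c : ℝ} (h0 : 0 ≤ c) (h1 : c ≤ 1) :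
    ∫ u in Ico (0 : ℝ) 1, (if u < c then (1 : ℝ) else 0) = c := by
  have : (fun u : ℝ => if u < c then (1 : ℝ) else 0) = (Iio c).indicator fun _ => 1 := by
    funext u
    simp [indicator]
  rw [this, integral_indicator_const _ measurableSet_Iio, smul_eq_mul, mul_one,
    measureReal_restrict_apply measurableSet_Iio, inter_comm, Ico_inter_Iio, min_eq_right h1]
  simp [h0]

theorem integrableOn_Ico_ite_lt (c : ℝ) :
    IntegrableOn (fun u : ℝ => if u < c then (1 : ℝ) else 0) (Ico (0 : ℝ) 1) := by
  have : (fun u : ℝ => if u < c then (1 : ℝ) else 0) = (Iio c).indicator fun _ => 1 := by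
    funext u
    simp [indicator]
  rw [this]
  exact (integrable_const _).indicator measurableSet_Iio

theorem setIntegral_Ico_sum_mul_ite_lt {ι : Type*} (s : Finset ι) (c h : ι → ℝ)
    (h0 : ∀ i ∈ s, 0 ≤ h i) (h1 : ∀ i ∈ s, h i ≤ 1) :
    ∫ u in Ico (0 : ℝ) 1, ∑ i ∈ s, c i * (if u < h i then (1 : ℝ) else 0) =
      ∑ i ∈ s, c i * h i := by
  rw [integral_finsetSum _ fun i _ => (integrableOn_Ico_ite_lt (h i)).const_mul (c i)]
  refine Finset.sum_congr rfl fun i hi => ?_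
  rw [integral_const_mul, setIntegral_Ico_ite_lt (h0 i hi) (h1 i hi)]

theorem finite_range_staircaseSup [Lattice M] [OrderBot M] {α : Type*} (a b : ℕ → M)
    (S : α → ℕ → ℕ → Prop) (m n : ℕ) : (range fun u => staircaseSup a b (S u) m n).Finite := by
  classical
  refine ((Finset.range (m + 1) ×ˢ Finset.range (n + 1)).powerset.image fun T =>
    T.sup fun x => a x.1 ⊓ b x.2).finite_toSet.subset ?_
  rintro _ ⟨u, rfl⟩
  simp only [Finset.coe_image, mem_image, Finset.mem_coe, Finset.mem_powerset]
  refine ⟨_, Finset.filter_subset (fun x => S u x.1 x.2) _, ?_⟩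
  rw [staircaseSup]

theorem antitone_staircaseSup_lt [Lattice M] [OrderBot M] (a b : ℕ → M) (h : ℕ → ℕ → ℝ)
    (m n : ℕ) : Antitone fun u : ℝ => staircaseSup a b (fun i j => u < h i j) m n :=
  fun _ _ huv => staircaseSup_mono fun _ _ => huv.trans_lt

theorem mem_toFinset_of_volume_ne_zero {H : ℝ → M} (hf : (range H).Finite) {p : M}
    (hp : volume.real (Ico 0 1 ∩ H ⁻¹' {p}) ≠ 0) : p ∈ hf.toFinset := by
  by_contra h
  have : H ⁻¹' {p} = ∅ := by
    ext u
    simp only [mem_preimage, mem_singleton_iff, mem_empty_iff_false, iff_false]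
    rintro rfl
    exact h (by simp)
  simp [this] at hp

namespace OrthoschemeComplex

/-- The point given by an antitone function on `[0, 1)` with finite range: the weight of `p` is
the measure of the fibre over `p`. -/
noncomputable def ofFiltration [PartialOrder M] (H : ℝ → M) (hH : Antitone H)
    (hf : (range H).Finite) : OrthoschemeComplex M where
  weight := Finsupp.onFinset hf.toFinset (fun p => volume.real (Ico 0 1 ∩ H ⁻¹' {p}))
    fun _ => mem_toFinset_of_volume_ne_zero hf
  weight_nonneg p := measureReal_nonneg
  weight_sum := by
    rw [Finsupp.sum_of_support_subset _ Finsupp.support_onFinset_subset _ (by simp)]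
    have := setIntegral_comp_of_antitone hH (V := hf.toFinset) (by simp) fun _ => 1
    simpa using this.symm
  isChain_support := by
    have : IsChain (· ≤ ·) (range H) := by
      rintro _ ⟨u, rfl⟩ _ ⟨v, rfl⟩ _
      rcases le_total u v with h | h
      · exact Or.inr (hH h)
      · exact Or.inl (hH h)
    refine this.mono fun p hp => ?_
    simpa using Finsupp.support_onFinset_subset hp

theorem support_ofFiltration_subset_toFinset [PartialOrder M] (H : ℝ → M) (hH : Antitone H)
    (hf : (range H).Finite) : (ofFiltration H hH hf).weight.support ⊆ hf.toFinset := by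
  exact Finsupp.support_onFinset_subset (hf := fun _ => mem_toFinset_of_volume_ne_zero hf)

theorem support_ofFiltration_subset [PartialOrder M] (H : ℝ → M) (hH : Antitone H)
    (hf : (range H).Finite) : ((ofFiltration H hH hf).weight.support : Set M) ⊆ range H :=
  fun _ hp => hf.mem_toFinset.1 (support_ofFiltration_subset_toFinset H hH hf hp)

variable [Lattice M]

/-- The weights are measures of fibres, so the sum over lattice elements is an integral over the
parameter. -/
theorem rankForm_ofFiltration {H : ℝ → M} (hH : Antitone H) (hf : (range H).Finite)
    (v : M →₀ ℝ) : rankForm (ofFiltration H hH hf).weight v =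
      ∫ u in Ico 0 1, rankForm (Finsupp.single (H u) 1) v := by
  rw [setIntegral_comp_of_antitone hH (V := hf.toFinset) (by simp)
    fun p => rankForm (Finsupp.single p 1) v]
  conv_lhs => rw [← Finsupp.sum_single (ofFiltration H hH hf).weight]
  rw [Finsupp.sum_of_support_subset _ (support_ofFiltration_subset_toFinset H hH hf) _
    (by simp), map_sum,
    LinearMap.sum_apply]
  refine Finset.sum_congr rfl fun p _ => ?_
  rw [← Finsupp.smul_single_one, map_smul, LinearMap.smul_apply, smul_eq_mul]
  rfl

variable [FiniteDimensionalOrder M] [IsModularLattice M]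

theorem latticeRank_staircaseSup_lt [OrderBot M] {a b : ℕ → M} (ha : Monotone a) (hb : Monotone b)
    (ha₀ : a 0 = ⊥) (hb₀ : b 0 = ⊥) {h : ℕ → ℕ → ℝ}
    (hh : ∀ i j i' j', i' ≤ i → j' ≤ j → h i j ≤ h i' j') (m n : ℕ) (u : ℝ) :
    (latticeRank (staircaseSup a b (fun i j => u < h i j) m n) : ℝ) =
      ∑ x ∈ Finset.range m ×ˢ Finset.range n, mixedDiff (meetRank a b) x.1 x.2 *
        if u < h (x.1 + 1) (x.2 + 1) then 1 else 0 := by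
  rw [latticeRank_staircaseSup ha hb ha₀ hb₀
    (fun i j i' j' hi hj hu => hu.trans_le (hh i j i' j' hi hj)), Finset.sum_product]
  simp

/-- The staircase filtration at level `(1 - t) * f i + t * g j` works. Its norm is computed exactly;
its pairing with a vertex is only bounded below, by `staircaseSup_inf_le`. -/
theorem exists_convexCombination [BoundedOrder M] {x y : OrthoschemeComplex M} {m n : ℕ}
    {a b : ℕ → M} {f g : ℕ → ℝ} (hx : x.IsFlag m a f) (hy : y.IsFlag n b g) {t : ℝ}
    (ht : t ∈ Icc (0 : ℝ) 1) : ∃ z : OrthoschemeComplex M,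
      (z.weight.support : Set M) ⊆
        range (fun u => staircaseSup a b (fun i j => u < (1 - t) * f i + t * g j) m n) ∧
      (∀ p, (1 - t) * rankForm x.weight (Finsupp.single p 1) +
        t * rankForm y.weight (Finsupp.single p 1) ≤
          rankForm z.weight (Finsupp.single p 1)) ∧
      rankForm z.weight z.weight = (1 - t) ^ 2 * rankForm x.weight x.weight +
        2 * t * (1 - t) * rankForm x.weight y.weight + t ^ 2 * rankForm y.weight y.weight := by
  have ht0 := ht.1
  have ht1 : 0 ≤ 1 - t := sub_nonneg.2 ht.2
  let h : ℕ → ℕ → ℝ := fun i j => (1 - t) * f i + t * g j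
  have hh : ∀ i j i' j', i' ≤ i → j' ≤ j → h i j ≤ h i' j' := fun i j i' j' hi hj =>
    add_le_add (mul_le_mul_of_nonneg_left (hx.anti hi) ht1)
      (mul_le_mul_of_nonneg_left (hy.anti hj) ht0)
  have h0 : ∀ z ∈ Finset.range m ×ˢ Finset.range n, 0 ≤ h (z.1 + 1) (z.2 + 1) := fun z hz => by
    simp only [Finset.mem_product, Finset.mem_range] at hz
    exact add_nonneg (mul_nonneg ht1 (hx.nonneg (by omega)))
      (mul_nonneg ht0 (hy.nonneg (by omega)))
  have h1 : ∀ z ∈ Finset.range m ×ˢ Finset.range n, h (z.1 + 1) (z.2 + 1) ≤ 1 := fun z _ => by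
    have h2 := mul_le_mul_of_nonneg_left (hx.le_one (z.1 + 1)) ht1
    have h3 := mul_le_mul_of_nonneg_left (hy.le_one (z.2 + 1)) ht0
    simp only [h]
    linarith
  let H : ℝ → M := fun u => staircaseSup a b (fun i j => u < h i j) m n
  have hH : Antitone H := antitone_staircaseSup_lt a b h m n
  have hf : (range H).Finite := finite_range_staircaseSup a b (fun (u : ℝ) i j => u < h i j) m n
  refine ⟨ofFiltration H hH hf, support_ofFiltration_subset H hH hf, fun p => ?_, ?_⟩
  -- The truncated chains form a staircase whose rank integrates to exactly the affine combination.
  · let a' : ℕ → M := fun i => a i ⊓ p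
    let b' : ℕ → M := fun j => b j ⊓ p
    let H' : ℝ → M := fun u => staircaseSup a' b' (fun i j => u < h i j) m n
    have hint : ∫ u in Ico 0 1, (latticeRank (H' u) : ℝ) =
        (1 - t) * rankForm x.weight (Finsupp.single p 1) +
          t * rankForm y.weight (Finsupp.single p 1) := by
      simp only [H', latticeRank_staircaseSup_lt (a := a') (b := b')
        (fun i j hij => inf_le_inf_right p (hx.mono hij))
        (fun i j hij => inf_le_inf_right p (hy.mono hij))
        (by simp [a', hx.zero]) (by simp [b', hy.zero]) hh]
      rw [setIntegral_Ico_sum_mul_ite_lt _ _ (fun z : ℕ × ℕ => h (z.1 + 1) (z.2 + 1)) h0 h1,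
        Finset.sum_product, hx.rankForm_single, hy.rankForm_single]
      have e1 := hy.sum_mixedDiff_right a m p fun i => f (i + 1)
      have e2 := hx.sum_mixedDiff_left b n p fun j => g (j + 1)
      simp only [mul_comm (f _), mul_comm (g _)]
      rw [← e1, ← e2]
      simp only [Finset.mul_sum, ← Finset.sum_add_distrib]
      exact Finset.sum_congr rfl fun i _ => Finset.sum_congr rfl fun j _ => by
        simp only [h, a', b']; ring
    rw [← hint, rankForm_ofFiltration]
    simp only [rankForm_single_single, mul_one, one_mul]
    refine setIntegral_mono (integrableOn_comp_of_antitone (antitone_staircaseSup_lt a' b' h m n)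
      (finite_range_staircaseSup a' b' (fun (u : ℝ) i j => u < h i j) m n)
      fun q => (latticeRank q : ℝ))
      (integrableOn_comp_of_antitone hH hf fun q => (latticeRank (q ⊓ p) : ℝ)) fun u => ?_
    exact Nat.cast_le.2 (latticeRank_mono (staircaseSup_inf_le a b _ m n p))
  -- As `H` is antitone, `H v ⊓ H u = H (max u v)`; the indicator of `max u v < h` is a product, so
  -- the double integral produces `h ^ 2`.
  · have hinf : ∀ u v, (latticeRank (H v ⊓ H u) : ℝ) =
        ∑ x ∈ Finset.range m ×ˢ Finset.range n, (mixedDiff (meetRank a b) x.1 x.2 *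
          if u < h (x.1 + 1) (x.2 + 1) then 1 else 0) *
            if v < h (x.1 + 1) (x.2 + 1) then 1 else 0 := by
      intro u v
      have : H v ⊓ H u = H (max u v) := by
        rcases le_total u v with huv | huv
        · rw [max_eq_right huv, inf_eq_left.2 (hH huv)]
        · rw [max_eq_left huv, inf_eq_right.2 (hH huv)]
      rw [this, latticeRank_staircaseSup_lt hx.mono hy.mono hx.zero hy.zero hh]
      refine Finset.sum_congr rfl fun x _ => ?_
      simp only [max_lt_iff]
      split_ifs <;> simp_all
    rw [rankForm_ofFiltration]
    simp only [rankForm_comm _ (ofFiltration H hH hf).weight, rankForm_ofFiltration,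
      rankForm_single_single, one_mul, hinf]
    have hinner : ∀ u : ℝ, ∫ v in Ico (0 : ℝ) 1, ∑ x ∈ Finset.range m ×ˢ Finset.range n,
        (mixedDiff (meetRank a b) x.1 x.2 * if u < h (x.1 + 1) (x.2 + 1) then 1 else 0) *
          (if v < h (x.1 + 1) (x.2 + 1) then (1 : ℝ) else 0) =
        ∑ x ∈ Finset.range m ×ˢ Finset.range n,
          (mixedDiff (meetRank a b) x.1 x.2 * h (x.1 + 1) (x.2 + 1)) *
            if u < h (x.1 + 1) (x.2 + 1) then 1 else 0 := fun u => by
      rw [setIntegral_Ico_sum_mul_ite_lt _ _ (fun z : ℕ × ℕ => h (z.1 + 1) (z.2 + 1)) h0 h1]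
      exact Finset.sum_congr rfl fun x _ => mul_right_comm _ _ _
    simp only [hinner]
    rw [setIntegral_Ico_sum_mul_ite_lt _ _ (fun z : ℕ × ℕ => h (z.1 + 1) (z.2 + 1)) h0 h1,
      Finset.sum_product, hx.rankForm_self_left hy, hx.rankForm_self_right hy, hx.rankForm_eq hy]
    simp only [Finset.mul_sum, ← Finset.sum_add_distrib]
    exact Finset.sum_congr rfl fun i _ => Finset.sum_congr rfl fun j _ => by
      simp only [h]; ring

end OrthoschemeComplex

end Filtration

/-! ### The metric and its geodesics -/

namespace OrthoschemeComplex

open Set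

variable {M : Type*} [Lattice M]

theorem rankForm_eq_sum_single (v w : M →₀ ℝ) :
    rankForm v w = ∑ p ∈ w.support, w p * rankForm v (Finsupp.single p 1) := by
  conv_lhs => rw [← Finsupp.sum_single w]
  rw [Finsupp.sum, map_sum]
  refine Finset.sum_congr rfl fun p _ => ?_
  rw [← Finsupp.smul_single_one, map_smul, smul_eq_mul]

theorem exists_mem_simplex_of_isChain {P : Type*} [PartialOrder P] {x y : OrthoschemeComplex P}
    {C : Set P} (hC : IsChain (· ≤ ·) C) (hx : (x.weight.support : Set P) ⊆ C)
    (hy : (y.weight.support : Set P) ⊆ C) : ∃ σ : LTSeries P, x ∈ simplex σ ∧ y ∈ simplex σ := by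
  classical
  have hne : (x.weight.support ∪ y.weight.support).Nonempty := by
    refine Finset.Nonempty.mono Finset.subset_union_left ?_
    rw [Finset.nonempty_iff_ne_empty]
    intro h
    have := x.sum_weight_eq_one h.subset
    simp at this
  obtain ⟨σ, hσ⟩ := exists_ltSeries_range_eq hne
    (hC.mono (by rw [Finset.coe_union]; exact union_subset hx hy))
  rw [Finset.coe_union] at hσ
  exact ⟨σ, by rw [simplex, hσ]; exact subset_union_left,
    by rw [simplex, hσ]; exact subset_union_right⟩

/-- Two incomparable joins would supply index pairs that `h` orders strictly one way and `k`
strictly the other. With `h = k` this shows that a single filtration is a chain. -/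
theorem staircaseSup_lt_le_or_le [OrderBot M] {a b : ℕ → M} {h k : ℕ → ℕ → ℝ} {m n : ℕ}
    (hhk : ∀ i ≤ m, ∀ j ≤ n, ∀ i' ≤ m, ∀ j' ≤ n, h i' j' < h i j → k i' j' ≤ k i j) (u v : ℝ) :
    staircaseSup a b (fun i j => u < h i j) m n ≤ staircaseSup a b (fun i j => v < k i j) m n ∨
      staircaseSup a b (fun i j => v < k i j) m n ≤
        staircaseSup a b (fun i j => u < h i j) m n := by
  by_contra! hcon
  simp only [staircaseSup_le_iff, not_forall] at hcon
  obtain ⟨⟨i, hi, j, hj, hu, hij⟩, ⟨i', hi', j', hj', hv, hij'⟩⟩ := hcon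
  have h1 : k i j ≤ v := not_lt.1 fun h => hij (le_staircaseSup hi hj h)
  have h2 : h i' j' ≤ u := not_lt.1 fun h => hij' (le_staircaseSup hi' hj' h)
  have := hhk i hi j hj i' hi' j' hj' (h2.trans_lt hu)
  linarith

theorem exists_lineMap [BoundedOrder M] [IsModularLattice M] [FiniteDimensionalOrder M]
    (x y : OrthoschemeComplex M) : ∃ (γ : ℝ → OrthoschemeComplex M) (T : Finset ℝ),
      (∀ t ∈ Icc (0 : ℝ) 1, ∀ w, sqDist w (γ t) ≤
        (1 - t) * sqDist w x + t * sqDist w y - t * (1 - t) * sqDist x y) ∧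
      ∀ s ∈ Icc (0 : ℝ) 1, ∀ t ∈ Icc (0 : ℝ) 1, s ≤ t → (∀ τ ∈ T, ¬(s < τ ∧ τ < t)) →
        ∃ σ : LTSeries M, γ s ∈ simplex σ ∧ γ t ∈ simplex σ := by
  classical
  obtain ⟨m, a, f, hx⟩ := x.exists_isFlag
  obtain ⟨n, b, g, hy⟩ := y.exists_isFlag
  let h : ℝ → ℕ → ℕ → ℝ := fun t i j => (1 - t) * f i + t * g j
  have : Nonempty (OrthoschemeComplex M) := ⟨x⟩
  choose! γ hγ using fun (t : ℝ) (ht : t ∈ Icc (0 : ℝ) 1) => exists_convexCombination hx hy ht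
  let I := Finset.range (m + 1) ×ˢ Finset.range (n + 1)
  -- The zeros in `t` of the affine functions `h t i j - h t i' j'`. A zero denominator merely adds
  -- the harmless breakpoint `0`.
  let T : Finset ℝ := (I ×ˢ I).image fun z =>
    (f z.1.1 - f z.2.1) / ((f z.1.1 - f z.2.1) - (g z.1.2 - g z.2.2))
  refine ⟨γ, T, fun t ht w => ?_, fun s hs t ht hst hT => ?_⟩
  · obtain ⟨-, h1, h2⟩ := hγ t ht
    have h3 : (1 - t) * rankForm x.weight w.weight + t * rankForm y.weight w.weight ≤
        rankForm (γ t).weight w.weight := by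
      rw [rankForm_eq_sum_single x.weight, rankForm_eq_sum_single y.weight,
        rankForm_eq_sum_single (γ t).weight, Finset.mul_sum, Finset.mul_sum,
        ← Finset.sum_add_distrib]
      refine Finset.sum_le_sum fun p _ => ?_
      have := mul_le_mul_of_nonneg_left (h1 p) (w.weight_nonneg p)
      linarith
    rw [sqDist_eq, sqDist_eq, sqDist_eq, sqDist_eq, h2, rankForm_comm w.weight (γ t).weight,
      rankForm_comm w.weight x.weight, rankForm_comm w.weight y.weight]
    linarith
  · have key : ∀ i ≤ m, ∀ j ≤ n, ∀ i' ≤ m, ∀ j' ≤ n, h s i' j' < h s i j → h t i' j' ≤ h t i j := by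
      intro i hi j hj i' hi' j' hj' hlt
      by_contra! hgt
      refine hT _ (Finset.mem_image_of_mem _ (a := ((i, j), (i', j'))) ?_) ?_
      · simp only [I, Finset.mem_product, Finset.mem_range]
        omega
      simp only [h] at hlt hgt
      have hE : 0 < (f i - f i') - (g j - g j') := by
        by_contra! hE
        nlinarith
      simp only
      rw [lt_div_iff₀ hE, div_lt_iff₀ hE]
      constructor <;> linarith
    refine exists_mem_simplex_of_isChain (C := _ ∪ _) ?_
      ((hγ s hs).1.trans subset_union_left) ((hγ t ht).1.trans subset_union_right)
    have hchain : ∀ r, IsChain (· ≤ ·)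
        (range fun u => staircaseSup a b (fun i j => u < h r i j) m n) := by
      rintro r _ ⟨u, rfl⟩ _ ⟨v, rfl⟩ _
      exact staircaseSup_lt_le_or_le (fun _ _ _ _ _ _ _ _ h => h.le) u v
    rw [isChain_union]
    refine ⟨hchain s, hchain t, ?_⟩
    rintro _ ⟨u, rfl⟩ _ ⟨v, rfl⟩ _
    exact staircaseSup_lt_le_or_le key u v

/-! ### Triangle inequality and definiteness. -/

theorem sqrt_le_sqrt_add_sqrt_of_forall {a b c : ℝ} (ha : 0 ≤ a) (hb : 0 ≤ b)
    (h : ∀ t ∈ Icc (0 : ℝ) 1, 0 ≤ (1 - t) * a + t * b - t * (1 - t) * c) : √c ≤ √a + √b := by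
  refine le_of_forall_pos_le_add fun ε hε => ?_
  -- The shift by `ε / 2` keeps `A + B` positive. At `t = A / (A + B)` the expression with `A ^ 2`,
  -- `B ^ 2`, `(A + B) ^ 2` in place of `a`, `b`, `c` is zero.
  obtain ⟨A, hA⟩ : ∃ A, A = √a + ε / 2 := ⟨_, rfl⟩
  obtain ⟨B, hB⟩ : ∃ B, B = √b + ε / 2 := ⟨_, rfl⟩
  have hA0 : 0 < A := by have := Real.sqrt_nonneg a; linarith
  have hB0 : 0 < B := by have := Real.sqrt_nonneg b; linarith
  have haA : a ≤ A ^ 2 := by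
    have := Real.sqrt_nonneg a
    nlinarith [Real.sq_sqrt ha]
  have hbB : b ≤ B ^ 2 := by
    have := Real.sqrt_nonneg b
    nlinarith [Real.sq_sqrt hb]
  have hAB : 0 < A + B := add_pos hA0 hB0
  have ht := h (A / (A + B)) ⟨by positivity, by rw [div_le_one hAB]; linarith⟩
  have h1 : 1 - A / (A + B) = B / (A + B) := by field_simp; ring
  rw [h1] at ht
  have h2 : B / (A + B) * a ≤ B / (A + B) * A ^ 2 :=
    mul_le_mul_of_nonneg_left haA (by positivity)
  have h3 : A / (A + B) * b ≤ A / (A + B) * B ^ 2 :=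
    mul_le_mul_of_nonneg_left hbB (by positivity)
  have h4 : B / (A + B) * A ^ 2 + A / (A + B) * B ^ 2 = A / (A + B) * (B / (A + B)) *
      (A + B) ^ 2 := by field_simp
  have h5 : 0 < A / (A + B) * (B / (A + B)) := by positivity
  have h6 : c ≤ (A + B) ^ 2 := by
    refine le_of_mul_le_mul_left ?_ h5
    linarith
  calc √c ≤ A + B := Real.sqrt_le_iff.2 ⟨hAB.le, h6⟩
    _ = √a + √b + ε := by rw [hA, hB]; ring

theorem sqrt_sqDist_triangle [BoundedOrder M] [IsModularLattice M] [FiniteDimensionalOrder M]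
    (x y z : OrthoschemeComplex M) : √(sqDist x z) ≤ √(sqDist x y) + √(sqDist y z) := by
  obtain ⟨γ, -, hγ, -⟩ := exists_lineMap x z
  refine sqrt_le_sqrt_add_sqrt_of_forall (sqDist_nonneg x y) (sqDist_nonneg y z) fun t ht => ?_
  have := hγ t ht y
  rw [sqDist_comm y x] at this
  exact (sqDist_nonneg y (γ t)).trans this

/-- By the triangle inequality `x` and `y` are equally far from every vertex. The vertex `⊥` pairs
to zero with everything, so it gives equal norms; the other vertices then give equal pairings. -/
theorem rankForm_single_eq_of_sqDist_eq_zero [BoundedOrder M] [IsModularLattice M]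
    [FiniteDimensionalOrder M] {x y : OrthoschemeComplex M} (h : sqDist x y = 0) (p : M) :
    rankForm x.weight (Finsupp.single p 1) = rankForm y.weight (Finsupp.single p 1) := by
  have key : ∀ q, sqDist x (vertex q) = sqDist y (vertex q) := by
    intro q
    have h1 := sqrt_sqDist_triangle x y (vertex q)
    have h2 := sqrt_sqDist_triangle y x (vertex q)
    rw [h, Real.sqrt_zero, zero_add] at h1
    rw [sqDist_comm y x, h, Real.sqrt_zero, zero_add] at h2
    exact (Real.sqrt_inj (sqDist_nonneg _ _) (sqDist_nonneg _ _)).1 (le_antisymm h1 h2)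
  have hbot : ∀ v : M →₀ ℝ, rankForm v (Finsupp.single ⊥ 1) = 0 := fun v => by
    rw [rankForm_comm, rankForm_eq_sum_single]
    simp [rankForm_single_single, latticeRank_bot]
  have h1 := key ⊥
  have h2 := key p
  simp only [sqDist_eq, vertex] at h1 h2
  rw [hbot, hbot, hbot] at h1
  linarith

/-- At a maximal element `p` of the support of `x - y`, the weight of `x` is not larger. -/
theorem weight_le_of_rankForm_single_eq [OrderBot M] [FiniteDimensionalOrder M]
    {x y : OrthoschemeComplex M}
    (h : ∀ p, rankForm x.weight (Finsupp.single p 1) = rankForm y.weight (Finsupp.single p 1))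
    {p : M} (hp : ∀ q, p < q → x.weight q = y.weight q) : x.weight p ≤ y.weight p := by
  classical
  by_contra! hlt
  let C := x.weight.support ∪ y.weight.support
  let D := {q ∈ y.weight.support | ¬ p ≤ q}
  -- Since the support of `y` is a chain, `p' < p` unless `p = ⊥`, a case excluded by the total
  -- weights. Pairing `x - y` with `p` minus `p'` kills the terms of the support of `y` that are not
  -- above `p`, leaves nonnegative ones and makes that of `p` positive, yet the total is zero.
  let p' : M := D.sup fun q => p ⊓ q
  have hp' : p' ≤ p := Finset.sup_le fun _ _ => inf_le_left
  have hsum : ∀ r, ∑ q ∈ C, (x.weight q - y.weight q) * (latticeRank (q ⊓ r) : ℝ) = 0 := by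
    intro r
    have h1 : ∀ z : OrthoschemeComplex M, z.weight.support ⊆ C →
        rankForm z.weight (Finsupp.single r 1) = ∑ q ∈ C, z.weight q * latticeRank (q ⊓ r) := by
      intro z hz
      rw [rankForm_comm, rankForm_eq_sum_single]
      simp only [rankForm_single_single, one_mul]
      rw [Finset.sum_subset hz (fun q _ hq => by simp [Finsupp.notMem_support_iff.1 hq])]
      exact Finset.sum_congr rfl fun q _ => by rw [inf_comm]
    simp only [sub_mul, Finset.sum_sub_distrib]
    rw [← h1 x Finset.subset_union_left, ← h1 y Finset.subset_union_right, h, sub_self]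
  have hpC : p ∈ C := by
    refine Finset.mem_union_left _ (Finsupp.mem_support_iff.2 ?_)
    have := y.weight_nonneg p
    linarith
  have hne : p' ≠ p := by
    intro heq
    rcases D.eq_empty_or_nonempty with hD | hD
    · have hbot : p = ⊥ := by rw [← heq]; simp [p', hD]
      have h1 : ∑ q ∈ C, x.weight q = ∑ q ∈ C, y.weight q := by
        rw [x.sum_weight_eq_one Finset.subset_union_left,
          y.sum_weight_eq_one Finset.subset_union_right]
      refine (Finset.sum_lt_sum (fun q _ => ?_) ⟨p, hpC, hlt⟩).ne' h1
      rcases (bot_le : ⊥ ≤ q).eq_or_lt with hq | hq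
      · rw [← hq, ← hbot]; exact hlt.le
      · exact (hp q (hbot ▸ hq)).ge
    · obtain ⟨q, hq, hmax⟩ := D.exists_maximal hD
      have : p' ≤ p ⊓ q := by
        refine Finset.sup_le fun r hr => inf_le_inf_left p ?_
        rcases y.isChain_support.total (Finset.mem_filter.1 hr).1 (Finset.mem_filter.1 hq).1 with
          h | h
        · exact h
        · exact hmax hr h
      rw [heq] at this
      exact (Finset.mem_filter.1 hq).2 (this.trans inf_le_right)
  have hzero : ∑ q ∈ C, (x.weight q - y.weight q) *
      ((latticeRank (q ⊓ p) : ℝ) - latticeRank (q ⊓ p')) = 0 := by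
    simp only [mul_sub _ (latticeRank _ : ℝ), Finset.sum_sub_distrib, hsum, sub_self]
  refine (Finset.sum_pos' (fun q _ => ?_) ⟨p, hpC, ?_⟩).ne' hzero
  · have hmono : (latticeRank (q ⊓ p') : ℝ) ≤ latticeRank (q ⊓ p) :=
      Nat.cast_le.2 (latticeRank_mono (inf_le_inf_left q hp'))
    by_cases hpq : p ≤ q
    · rcases hpq.eq_or_lt with rfl | hpq
      · exact mul_nonneg (sub_nonneg.2 hlt.le) (sub_nonneg.2 hmono)
      · rw [hp q hpq, sub_self, zero_mul]
    · by_cases hq : q ∈ y.weight.support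
      · have h1 : q ⊓ p ≤ p' := by
          rw [inf_comm]
          exact Finset.le_sup (f := fun q => p ⊓ q) (Finset.mem_filter.2 ⟨hq, hpq⟩)
        have h2 : q ⊓ p = q ⊓ p' :=
          le_antisymm (le_inf inf_le_left h1) (inf_le_inf_left q hp')
        rw [h2, sub_self, mul_zero]
      · rw [Finsupp.notMem_support_iff.1 hq, sub_zero]
        exact mul_nonneg (x.weight_nonneg q) (sub_nonneg.2 hmono)
  · refine mul_pos (sub_pos.2 hlt) (sub_pos.2 (Nat.cast_lt.2 (latticeRank_strictMono ?_)))
    rw [inf_idem, inf_eq_right.2 hp']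
    exact lt_of_le_of_ne hp' hne

theorem eq_of_sqDist_eq_zero [BoundedOrder M] [IsModularLattice M]
    [FiniteDimensionalOrder M] {x y : OrthoschemeComplex M} (h : sqDist x y = 0) : x = y := by
  have := wellFoundedGT_of_finiteDimensionalOrder (M := M)
  have h' := rankForm_single_eq_of_sqDist_eq_zero h
  refine OrthoschemeComplex.ext (Finsupp.ext fun p => ?_)
  induction p using WellFoundedGT.induction with
  | _ p ih =>
    exact le_antisymm (weight_le_of_rankForm_single_eq h' ih)
      (weight_le_of_rankForm_single_eq (fun q => (h' q).symm) fun q hq => (ih q hq).symm)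

/-- The metric on the orthoscheme complex of a modular lattice of finite rank. -/
noncomputable instance [BoundedOrder M] [IsModularLattice M] [FiniteDimensionalOrder M] :
    MetricSpace (OrthoschemeComplex M) where
  dist x y := √(sqDist x y)
  dist_self x := by rw [sqDist_self, Real.sqrt_zero]
  dist_comm x y := by rw [sqDist_comm]
  dist_triangle := sqrt_sqDist_triangle
  eq_of_dist_eq_zero {x y} h := eq_of_sqDist_eq_zero ((Real.sqrt_eq_zero (sqDist_nonneg x y)).1 h)

/-! ### Geodesics and the comparison inequality. -/

section Metric

variable [BoundedOrder M] [IsModularLattice M] [FiniteDimensionalOrder M]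

theorem dist_eq_sqrt (x y : OrthoschemeComplex M) : dist x y = √(sqDist x y) := rfl

theorem dist_sq (x y : OrthoschemeComplex M) : dist x y ^ 2 = sqDist x y :=
  Real.sq_sqrt (sqDist_nonneg x y)

theorem exists_lineMap_dist (x y : OrthoschemeComplex M) :
    ∃ (γ : ℝ → OrthoschemeComplex M) (T : Finset ℝ), γ 0 = x ∧ γ 1 = y ∧
      (∀ t ∈ Icc (0 : ℝ) 1, ∀ w, dist w (γ t) ^ 2 ≤
        (1 - t) * dist w x ^ 2 + t * dist w y ^ 2 - t * (1 - t) * dist x y ^ 2) ∧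
      (∀ s ∈ Icc (0 : ℝ) 1, ∀ t ∈ Icc (0 : ℝ) 1, dist (γ s) (γ t) = |s - t| * dist x y) ∧
      ∀ s ∈ Icc (0 : ℝ) 1, ∀ t ∈ Icc (0 : ℝ) 1, s ≤ t → (∀ τ ∈ T, ¬(s < τ ∧ τ < t)) →
        ∃ σ : LTSeries M, γ s ∈ simplex σ ∧ γ t ∈ simplex σ := by
  obtain ⟨γ, T, h, hT⟩ := exists_lineMap x y
  simp only [← dist_sq] at h
  have h0 : γ 0 = x := by
    have := h 0 ⟨le_rfl, zero_le_one⟩ x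
    rw [dist_self] at this
    have h1 : dist x (γ 0) ^ 2 ≤ 0 := by linarith
    exact (dist_eq_zero.1 (pow_eq_zero_iff two_ne_zero |>.1 (le_antisymm h1 (sq_nonneg _)))).symm
  have h1 : γ 1 = y := by
    have := h 1 ⟨zero_le_one, le_rfl⟩ y
    rw [dist_self] at this
    have h1 : dist y (γ 1) ^ 2 ≤ 0 := by linarith
    exact (dist_eq_zero.1 (pow_eq_zero_iff two_ne_zero |>.1 (le_antisymm h1 (sq_nonneg _)))).symm
  -- The inequality bounds the distances from `γ s` to `x` and `y`; used again with `w = γ s`, it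
  -- rests on `(1 - t) * s ^ 2 + t * (1 - s) ^ 2 - t * (1 - t) = (s - t) ^ 2`.
  have hle : ∀ s ∈ Icc (0 : ℝ) 1, ∀ t ∈ Icc (0 : ℝ) 1, dist (γ s) (γ t) ≤ |s - t| * dist x y := by
    intro s hs t ht
    have e1 := h s hs x
    have e2 := h s hs y
    have e3 := h t ht (γ s)
    rw [dist_self, dist_comm x (γ s)] at e1
    rw [dist_self, dist_comm y (γ s), dist_comm y x] at e2
    have e4 := mul_le_mul_of_nonneg_left e1 (sub_nonneg.2 ht.2)
    have e5 := mul_le_mul_of_nonneg_left e2 ht.1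
    refine abs_le_of_sq_le_sq' ?_ (by positivity) |>.2
    rw [mul_pow, sq_abs]
    linarith
  refine ⟨γ, T, h0, h1, h, ?_, hT⟩
  -- The three upper bounds along `x, γ s, γ t, y` add up to `dist x y`, so none of them can be
  -- strict.
  have hge : ∀ s ∈ Icc (0 : ℝ) 1, ∀ t ∈ Icc (0 : ℝ) 1, s ≤ t →
      |s - t| * dist x y ≤ dist (γ s) (γ t) := by
    intro s hs t ht hst
    have e1 := hle 0 ⟨le_rfl, zero_le_one⟩ s hs
    have e2 := hle t ht 1 ⟨zero_le_one, le_rfl⟩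
    have e3 := dist_triangle4 (γ 0) (γ s) (γ t) (γ 1)
    rw [h0, zero_sub, abs_neg, abs_of_nonneg hs.1] at e1
    rw [h1, abs_sub_comm, abs_of_nonneg (sub_nonneg.2 ht.2)] at e2
    rw [h0, h1] at e3
    rw [abs_sub_comm, abs_of_nonneg (sub_nonneg.2 hst)]
    linarith
  intro s hs t ht
  refine le_antisymm (hle s hs t ht) ?_
  rcases le_total s t with hst | hst
  · exact hge s hs t ht hst
  · rw [abs_sub_comm, dist_comm (γ s)]
    exact hge t ht s hs hst

theorem isCAT0 : IsCAT0 (OrthoschemeComplex M) := by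
  refine ⟨fun x y => ?_, ?_⟩
  · obtain ⟨γ, -, h0, h1, -, h, -⟩ := exists_lineMap_dist x y
    rcases eq_or_ne x y with rfl | hxy
    · refine ⟨fun _ => x, rfl, rfl, fun s hs t ht => ?_⟩
      rw [dist_self, Icc_self, mem_singleton_iff] at hs ht
      simp [hs, ht]
    have hd : 0 < dist x y := dist_pos.2 hxy
    have hmem : ∀ s ∈ Icc 0 (dist x y), s / dist x y ∈ Icc (0 : ℝ) 1 := fun s hs =>
      ⟨div_nonneg hs.1 hd.le, (div_le_one hd).2 hs.2⟩
    refine ⟨fun s => γ (s / dist x y), by simp [h0], by simp [div_self hd.ne', h1],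
      fun s hs t ht => ?_⟩
    rw [h _ (hmem s hs) _ (hmem t ht), ← sub_div, abs_div, abs_of_pos hd,
      div_mul_cancel₀ _ hd.ne']
  · rintro x₁ x₂ x₃ - - - - - - x₁' x₂' x₃' h₁₂ h₂₃ h₃₁ y - y' ⟨r, t, hr, ht, hrt, rfl⟩ hy₁ hy₂
    obtain rfl : r = 1 - t := by linarith
    obtain ⟨γ, -, -, -, hγ, -, -⟩ := exists_lineMap_dist x₁ x₂
    have htI : t ∈ Icc (0 : ℝ) 1 := ⟨ht, by linarith⟩
    have e1 : dist x₁' ((1 - t) • x₁' + t • x₂') = t * dist x₁ x₂ := by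
      have : x₁' - ((1 - t) • x₁' + t • x₂') = t • (x₁' - x₂') := by module
      rw [← h₁₂, dist_eq_norm, this, norm_smul, Real.norm_of_nonneg ht, dist_eq_norm]
    have e2 : dist x₂' ((1 - t) • x₁' + t • x₂') = (1 - t) * dist x₁ x₂ := by
      have : x₂' - ((1 - t) • x₁' + t • x₂') = (1 - t) • (x₂' - x₁') := by module
      rw [← h₁₂, dist_comm x₁', dist_eq_norm, this, norm_smul, Real.norm_of_nonneg hr,
        dist_eq_norm]
    -- With distances `t * d` and `(1 - t) * d` to the ends, where `d = dist x₁ x₂`, the right-hand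
    -- side for `w = y` is zero: geodesics are unique.
    have hy : y = γ t := by
      have := hγ t htI y
      rw [dist_comm y x₁, dist_comm y x₂, ← hy₁, ← hy₂, e1, e2] at this
      have h1 : dist y (γ t) ^ 2 ≤ 0 := by nlinarith
      exact dist_eq_zero.1 (pow_eq_zero_iff two_ne_zero |>.1 (le_antisymm h1 (sq_nonneg _)))
    -- Stewart's theorem: in the plane the inequality is an equality.
    have hcomp : dist x₃' ((1 - t) • x₁' + t • x₂') ^ 2 = (1 - t) * dist x₃ x₁ ^ 2 +
        t * dist x₃ x₂ ^ 2 - t * (1 - t) * dist x₁ x₂ ^ 2 := by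
      have h1 : x₃' - ((1 - t) • x₁' + t • x₂') = (1 - t) • (x₃' - x₁') + t • (x₃' - x₂') := by
        module
      have h2 : x₁' - x₂' = (x₃' - x₂') - (x₃' - x₁') := by abel
      rw [dist_comm x₃ x₂, ← h₁₂, ← h₂₃, ← h₃₁, dist_comm x₂' x₃', dist_eq_norm, dist_eq_norm,
        dist_eq_norm, dist_eq_norm, h1, h2]
      generalize x₃' - x₁' = u
      generalize x₃' - x₂' = v
      rw [norm_add_sq_real, norm_sub_sq_real, norm_smul, norm_smul, real_inner_smul_left,
        real_inner_smul_right, Real.norm_of_nonneg hr, Real.norm_of_nonneg ht, real_inner_comm v]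
      ring
    refine abs_le_of_sq_le_sq' ?_ dist_nonneg |>.2
    rw [hcomp, hy]
    exact hγ t htI x₃

end Metric

end OrthoschemeComplex

/-! ### The length metric -/

namespace OrthoschemeComplex

open Set

section Path

variable {P : Type*} [PartialOrder P]

/-- The path that runs through a segment from `x` to `y` and then through `w`. -/
def FinitePath.cons {x y z : OrthoschemeComplex P} (σ : LTSeries P) (hx : x ∈ simplex σ)
    (hy : y ∈ simplex σ) (w : FinitePath y z) : FinitePath x z where
  m := w.m + 1
  u := Fin.cons x w.u
  σ := Fin.cons σ w.σ
  source := rfl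
  target := by rw [← Fin.succ_last, Fin.cons_succ, w.target]
  left_mem i := by
    refine Fin.cases hx (fun i => ?_) i
    rw [← Fin.succ_castSucc, Fin.cons_succ, Fin.cons_succ]
    exact w.left_mem i
  right_mem i := by
    refine Fin.cases ?_ (fun i => ?_) i
    · rw [Fin.cons_succ, Fin.cons_zero, w.source]
      exact hy
    · rw [Fin.cons_succ, Fin.cons_succ]
      exact w.right_mem i

theorem FinitePath.length_cons {x y z : OrthoschemeComplex P} (σ : LTSeries P)
    (hx : x ∈ simplex σ) (hy : y ∈ simplex σ) (w : FinitePath y z) :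
    (w.cons σ hx hy).length = edist (orthoschemeMap σ x) (orthoschemeMap σ y) + w.length := by
  have : (w.cons σ hx hy).length = ∑ i : Fin (w.m + 1),
      edist (orthoschemeMap ((w.cons σ hx hy).σ i) ((w.cons σ hx hy).u i.castSucc))
        (orthoschemeMap ((w.cons σ hx hy).σ i) ((w.cons σ hx hy).u i.succ)) := rfl
  rw [this, Fin.sum_univ_succ]
  congr 1
  change edist (orthoschemeMap σ x) (orthoschemeMap σ (w.u 0)) = _
  rw [w.source]

theorem lengthDist_le_edist_add {x y z : OrthoschemeComplex P} {σ : LTSeries P}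
    (hx : x ∈ simplex σ) (hy : y ∈ simplex σ) :
    lengthDist x z ≤ edist (orthoschemeMap σ x) (orthoschemeMap σ y) + lengthDist y z := by
  rw [lengthDist, lengthDist, ENNReal.add_iInf]
  exact le_iInf fun w => (iInf_le _ (w.cons σ hx hy)).trans (w.length_cons σ hx hy).le

theorem lengthDist_self (x : OrthoschemeComplex P) : lengthDist x x = 0 := by
  let w : FinitePath x x := ⟨0, fun _ => x, Fin.elim0, rfl, rfl, fun i => i.elim0, fun i => i.elim0⟩
  have hw : w.length = 0 := Finset.sum_empty
  exact le_antisymm ((iInf_le _ w).trans hw.le) zero_le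

theorem sum_weight_simplex {x : OrthoschemeComplex P} {σ : LTSeries P} (hx : x ∈ simplex σ)
    {A : Type*} [AddCommMonoid A] (F : P → ℝ → A) (hF : ∀ p, F p 0 = 0) :
    x.weight.sum F = ∑ i, F (σ.toFun i) (x.weight (σ.toFun i)) := by
  classical
  have hinj : Function.Injective σ.toFun := σ.strictMono.injective
  rw [← Finset.sum_image (f := fun p => F p (x.weight p)) hinj.injOn]
  refine Finsupp.sum_of_support_subset _ (fun p hp => ?_) _ fun p _ => hF p
  obtain ⟨i, rfl⟩ := hx hp
  exact Finset.mem_image_of_mem _ (Finset.mem_univ i)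

theorem orthoschemeMap_apply (σ : LTSeries P) (x : OrthoschemeComplex P)
    (j : Fin (intervalLength σ.head σ.last)) : orthoschemeMap σ x j =
      ∑ i, x.weight (σ.toFun i) *
        if j.val < intervalLength σ.head (σ.toFun i) then 1 else 0 := by
  simp [orthoschemeMap, Finset.sum_ite]

end Path

/-! ### Comparison of the metric with `D₂`. -/

variable {M : Type*} [Lattice M] [BoundedOrder M] [IsModularLattice M] [FiniteDimensionalOrder M]

theorem sum_fin_ite_lt_mul_ite_lt {N r s : ℕ} (hr : r ≤ N) :
    ∑ j : Fin N, (if j.val < r then (1 : ℝ) else 0) * (if j.val < s then 1 else 0) =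
      min r s := by
  rw [Fin.sum_univ_eq_sum_range (fun j => (if j < r then (1 : ℝ) else 0) * if j < s then 1 else 0)]
  have : ∀ j ∈ Finset.range N, (if j < r then (1 : ℝ) else 0) * (if j < s then 1 else 0) =
      if j < min r s then 1 else 0 := fun j _ => by
    simp only [lt_min_iff]
    split_ifs <;> simp_all
  rw [Finset.sum_congr rfl this, sum_range_ite_lt ((min_le_left r s).trans hr) fun _ => 1]
  simp

/-- Both squared distances have Gram matrix `min (r i) (r k)`, up to the constant rank of `σ.head`,
which drops out because the weight differences sum to zero. -/
theorem dist_orthoschemeMap {x y : OrthoschemeComplex M} {σ : LTSeries M} (hx : x ∈ simplex σ)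
    (hy : y ∈ simplex σ) : dist (orthoschemeMap σ x) (orthoschemeMap σ y) = dist x y := by
  let δ : Fin (σ.length + 1) → ℝ := fun i => x.weight (σ.toFun i) - y.weight (σ.toFun i)
  let r : Fin (σ.length + 1) → ℕ := fun i => intervalLength σ.head (σ.toFun i)
  have hδ : ∑ i, δ i = 0 := by
    have h1 := sum_weight_simplex hx (fun _ a => a) fun _ => rfl
    have h2 := sum_weight_simplex hy (fun _ a => a) fun _ => rfl
    rw [x.weight_sum] at h1
    rw [y.weight_sum] at h2
    rw [Finset.sum_sub_distrib, ← h1, ← h2, sub_self]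
  have hr : ∀ i, latticeRank (σ.toFun i) = latticeRank σ.head + r i := fun i =>
    (latticeRank_add_intervalLength (σ.head_le i)).symm
  have hrN : ∀ i, r i ≤ intervalLength σ.head σ.last := fun i => by
    have h1 := latticeRank_mono (σ.monotone (Fin.le_last i))
    have h2 := hr i
    have h3 : latticeRank σ.last = _ := (latticeRank_add_intervalLength σ.head_le_last).symm
    change latticeRank (σ.toFun i) ≤ latticeRank σ.last at h1
    omega
  have hmeet : ∀ i k, (latticeRank (σ.toFun i ⊓ σ.toFun k) : ℝ) =
      latticeRank σ.head + (min (r i) (r k) : ℕ) := fun i k => by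
    have hi := hr i
    have hk := hr k
    rcases le_total i k with h | h
    · have hle := σ.monotone h
      have := latticeRank_mono hle
      rw [inf_eq_left.2 hle, hi, min_eq_left (by omega)]
      push_cast; rfl
    · have hle := σ.monotone h
      have := latticeRank_mono hle
      rw [inf_eq_right.2 hle, hk, min_eq_right (by omega)]
      push_cast; rfl
  have hform : sqDist x y = ∑ i, ∑ k, δ i * δ k * (min (r i) (r k) : ℕ) := by
    have h1 : x.weight - y.weight = ∑ i, Finsupp.single (σ.toFun i) (δ i) := by
      have h1 := sum_weight_simplex hx Finsupp.single (by simp)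
      have h2 := sum_weight_simplex hy Finsupp.single (by simp)
      rw [Finsupp.sum_single] at h1 h2
      rw [h1, h2, ← Finset.sum_sub_distrib]
      simp only [δ, Finsupp.single_sub]
    rw [sqDist, h1]
    simp only [map_sum, LinearMap.sum_apply, rankForm_single_single, hmeet, mul_add,
      Finset.sum_add_distrib]
    rw [Finset.sum_comm]
    simp only [← Finset.sum_mul, ← Finset.mul_sum, hδ]
    rw [zero_mul, zero_mul, zero_add, Finset.sum_comm]
  rw [EuclideanSpace.dist_eq, dist_eq_sqrt, hform]
  congr 1
  simp only [Real.dist_eq, sq_abs, orthoschemeMap_apply, ← Finset.sum_sub_distrib, ← sub_mul]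
  simp only [sq, Finset.sum_mul_sum]
  rw [Finset.sum_comm]
  refine Finset.sum_congr rfl fun i _ => ?_
  rw [Finset.sum_comm]
  refine Finset.sum_congr rfl fun k _ => ?_
  rw [← sum_fin_ite_lt_mul_ite_lt (hrN i), Finset.mul_sum]
  exact Finset.sum_congr rfl fun j _ => by ring

theorem edist_orthoschemeMap {x y : OrthoschemeComplex M} {σ : LTSeries M} (hx : x ∈ simplex σ)
    (hy : y ∈ simplex σ) : edist (orthoschemeMap σ x) (orthoschemeMap σ y) = edist x y := by
  rw [edist_dist, edist_dist, dist_orthoschemeMap hx hy]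

theorem FinitePath.edist_le_length {x y : OrthoschemeComplex M} (w : FinitePath x y) :
    edist x y ≤ w.length := by
  let v : ℕ → OrthoschemeComplex M := fun i => w.u ⟨min i w.m, by omega⟩
  have h := edist_le_range_sum_edist v w.m
  have h0 : v 0 = x := by
    rw [← w.source]
    simp [v]
  have hm : v w.m = y := by
    refine Eq.trans ?_ w.target
    simp [v, Fin.last]
  rw [h0, hm, ← Fin.sum_univ_eq_sum_range fun i => edist (v i) (v (i + 1))] at h
  refine h.trans_eq (Finset.sum_congr rfl fun i _ => ?_)
  rw [edist_orthoschemeMap (w.left_mem i) (w.right_mem i)]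
  have h1 : v i = w.u i.castSucc := by
    simp only [v]
    congr 1
    ext
    simp [i.2.le]
  have h2 : v (i + 1) = w.u i.succ := by
    simp only [v]
    congr 1
    ext
    simp only [Fin.val_succ]
    omega
  rw [h1, h2]

/-- The geodesic is cut at its breakpoints, by induction on their number in the open interval: the
piece up to the first one lies in a single simplex. -/
theorem lengthDist_le_edist (x y : OrthoschemeComplex M) : lengthDist x y ≤ edist x y := by
  classical
  obtain ⟨γ, T, h0, h1, -, h, hT⟩ := exists_lineMap_dist x y
  have key : ∀ (n : ℕ) (s t : ℝ), s ∈ Icc (0 : ℝ) 1 → t ∈ Icc (0 : ℝ) 1 → s ≤ t →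
      (T.filter fun τ => s < τ ∧ τ < t).card ≤ n →
      lengthDist (γ s) (γ t) ≤ ENNReal.ofReal ((t - s) * dist x y) := by
    intro n
    induction n with
    | zero =>
      intro s t hs ht hst hcard
      obtain ⟨σ, hσ₁, hσ₂⟩ := hT s hs t ht hst
        (Finset.filter_eq_empty_iff.1 (Finset.card_eq_zero.1 (Nat.le_zero.1 hcard)))
      refine (lengthDist_le_edist_add hσ₁ hσ₂).trans_eq ?_
      rw [lengthDist_self, add_zero, edist_orthoschemeMap hσ₁ hσ₂, edist_dist, h s hs t ht,
        abs_sub_comm, abs_of_nonneg (sub_nonneg.2 hst)]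
    | succ n ih =>
      intro s t hs ht hst hcard
      rcases (T.filter fun τ => s < τ ∧ τ < t).eq_empty_or_nonempty with he | hne
      · exact ih s t hs ht hst (by simp [he])
      obtain ⟨τ, hτ, hmin⟩ := Finset.exists_minimal hne
      obtain ⟨hτT, hsτ, hτt⟩ := Finset.mem_filter.1 hτ
      have hτI : τ ∈ Icc (0 : ℝ) 1 := ⟨hs.1.trans hsτ.le, hτt.le.trans ht.2⟩
      obtain ⟨σ, hσ₁, hσ₂⟩ := hT s hs τ hτI hsτ.le fun τ' hτ' hlt =>
        (hlt.2.trans_le (hmin (Finset.mem_filter.2 ⟨hτ', hlt.1, hlt.2.trans hτt⟩) hlt.2.le)).false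
      have hcard' : (T.filter fun τ' => τ < τ' ∧ τ' < t).card ≤ n := by
        refine Nat.le_of_lt_succ (lt_of_lt_of_le (Finset.card_lt_card ?_) hcard)
        refine (Finset.ssubset_iff_of_subset fun τ' hτ' => ?_).2 ⟨τ, hτ, by simp⟩
        obtain ⟨hT', h1, h2⟩ := Finset.mem_filter.1 hτ'
        exact Finset.mem_filter.2 ⟨hT', hsτ.trans h1, h2⟩
      refine (lengthDist_le_edist_add hσ₁ hσ₂).trans
        ((add_le_add_right (ih τ t hτI ht hτt.le hcard') _).trans_eq ?_)
      rw [edist_orthoschemeMap hσ₁ hσ₂, edist_dist, h s hs τ hτI, abs_sub_comm,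
        abs_of_nonneg (sub_nonneg.2 hsτ.le), ← ENNReal.ofReal_add
        (mul_nonneg (sub_nonneg.2 hsτ.le) dist_nonneg)
        (mul_nonneg (sub_nonneg.2 hτt.le) dist_nonneg)]
      congr 1
      ring
  have := key _ 0 1 ⟨le_rfl, zero_le_one⟩ ⟨zero_le_one, le_rfl⟩ zero_le_one le_rfl
  rwa [h0, h1, sub_zero, one_mul, ← edist_dist] at this

theorem edist_eq_lengthDist (x y : OrthoschemeComplex M) : edist x y = lengthDist x y :=
  le_antisymm (le_iInf fun w => w.edist_le_length) (lengthDist_le_edist x y)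

end OrthoschemeComplex

theorem mainTheorem1 {M : Type*} [Lattice M] [IsModularLattice M] [FiniteDimensionalOrder M] :
    ∃ m : MetricSpace (OrthoschemeComplex M),
      (∀ x y : OrthoschemeComplex M, edist x y = OrthoschemeComplex.lengthDist x y) ∧
        IsCAT0 (OrthoschemeComplex M) := by
  have := wellFoundedLT_of_finiteDimensionalOrder (M := M)
  have := wellFoundedGT_of_finiteDimensionalOrder (M := M)
  have := LTSeries.nonempty_of_finiteDimensionalOrder M
  -- Bounded chains give a minimal and a maximal element; in a lattice these are the least and the
  -- greatest.
  obtain ⟨a, -, ha⟩ := WellFounded.has_min (wellFounded_lt (α := M)) Set.univ Set.univ_nonempty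
  obtain ⟨b, -, hb⟩ := WellFounded.has_min (wellFounded_gt (α := M)) Set.univ Set.univ_nonempty
  let _ : BoundedOrder M :=
    { bot := a
      bot_le := fun x => inf_eq_left.1 <|
        (inf_le_left.eq_or_lt).resolve_right (ha (a ⊓ x) (Set.mem_univ _))
      top := b
      le_top := fun x => sup_eq_left.1 <| Eq.symm <|
        (le_sup_left.eq_or_lt).resolve_right (hb (b ⊔ x) (Set.mem_univ _)) }
  exact ⟨inferInstance, OrthoschemeComplex.edist_eq_lengthDist, OrthoschemeComplex.isCAT0⟩
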